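/- Let $G$ be a finite simple graph. For $A\subseteq V(G)$ write $N_G(A)$ for the set of vertices outside $A$ that have a neighbour in $A$, and $N_G(x)=N_G(\{x\})$. For $v\in V(G)$ and an integer $k\ge 1$ let $B_G(v,k)$ and $\partial_G(v,k)$ be the sets of vertices at graph distance at most $k$, respectively exactly $k$, from $v$. Let $A\subseteq B_G(v,k-1)$ be the maximal set such that $$|N_G(x)\cap (A\cup\partial_G(v,k))|\ge 4\quad\text{for every } x\in (A\cup N_G(A))\setminus \partial_G(v,k)$$ (it exists, since this property is preserved under unions), and put $$S_k(G,v)=A\cup\partial_G(v,k),\qquad P_k(G,v)=N_G\bigl(S_k(G,v)\setminus\partial_G(v,k)\bigr)\setminus\partial_G(v,k),$$ $$R_k(G,v)=B_G(v,k)\setminus\bigl(S_k(G,v)\cup P_k(G,v)\bigr).$$ For a graph $H$ and a set $W$ of vertices, let $\mathrm{uc}(H;W)$ be the minimum, over all sets of vertex-disjoint paths in $H$ (paths of length $0$ being allowed) all of whose endpoints lie in $W$, of the number of vertices in $V(H)\setminus W$ that lie on none of the paths. If $v\notin S_k(G,v)$, let $C_v^k$ be the vertex set of the connected component of $G[P_k(G,v)\cup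 R_k(G,v)]$ containing $v$. Define $$\phi_{G,k}(v)=0\ \text{ if } v\in S_k(G,v),\qquad \phi_{G,k}(v)=\frac{\mathrm{uc}\bigl(G[C_v^k];P_k(G,v)\cap C_v^k\bigr)}{|C_v^k|}\ \text{ otherwise},$$ $$\widetilde L_k(G)=|V(G)|-\sum_{v\in V(G)}\phi_{G,k}(v).$$ **Lemma.** For every real $c\ge 20$ and every integer $k\ge 100$ there is $n_0=n_0(c,k)$ such that for all $n\ge n_0$ the following holds. Let $G\sim G(n,\tfrac cn)$ be the binomial random graph on $n$ vertices, in which each pair of vertices is an edge independently with probability $\tfrac cn$. Then $$\operatorname{Var}\bigl(\widetilde L_k(G)\bigr)\ \ge\ 2A_c\,n,\qquad\text{where } A_c=\tfrac1{12}e^{-20c}>0 .$$ -/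

import Mathlib

namespace LongCycle

variable {V : Type*}

/-- The external neighbourhood `N_G(A)`: the vertices outside `A` with a neighbour in `A`. -/
def extNbhd (G : SimpleGraph V) (A : Set V) : Set V :=
  {x | x ∉ A ∧ ∃ y ∈ A, G.Adj x y}

/-- The ball `B_G(v,k)` in the (extended) graph distance. -/
def ball (G : SimpleGraph V) (v : V) (k : ℕ) : Set V :=
  {x | G.edist v x ≤ k}

/-- The sphere `∂_G(v,k)` in the (extended) graph distance. -/
def sphere (G : SimpleGraph V) (v : V) (k : ℕ) : Set V :=
  {x | G.edist v x = k}

/-- `A ⊆ B_G(v,k-1)`, and every `x ∈ (A ∪ N_G(A)) \ ∂_G(v,k)` has at least four neighbours in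
`A ∪ ∂_G(v,k)`. -/
def HasLocalCoreProperty (G : SimpleGraph V) (v : V) (k : ℕ) (A : Set V) : Prop :=
  A ⊆ ball G v (k - 1) ∧
    ∀ x ∈ (A ∪ extNbhd G A) \ sphere G v k,
      4 ≤ (G.neighborSet x ∩ (A ∪ sphere G v k)).encard

/-- The maximal set with the local strong `4`-core property, obtained as the union of all such
sets; `isGreatest_localCoreInner` shows that it is indeed the maximum. -/
def localCoreInner (G : SimpleGraph V) (v : V) (k : ℕ) : Set V :=
  ⋃₀ {A | HasLocalCoreProperty G v k A}

theorem isGreatest_localCoreInner (G : SimpleGraph V) (v : V) (k : ℕ) :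
    IsGreatest {A | HasLocalCoreProperty G v k A} (localCoreInner G v k) := by
  refine ⟨⟨Set.sUnion_subset fun A hA => hA.1, ?_⟩, fun A hA => Set.subset_sUnion_of_mem hA⟩
  rintro x ⟨hx, hxs⟩
  have key : ∃ A, HasLocalCoreProperty G v k A ∧ x ∈ A ∪ extNbhd G A := by
    rcases hx with ⟨A, hA, hxA⟩ | ⟨hx, y, ⟨A, hA, hyA⟩, hxy⟩
    · exact ⟨A, hA, Or.inl hxA⟩
    · exact ⟨A, hA, Or.inr ⟨fun h => hx ⟨A, hA, h⟩, y, hyA, hxy⟩⟩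
  obtain ⟨A, hA, hxA⟩ := key
  refine (hA.2 x ⟨hxA, hxs⟩).trans (Set.encard_le_encard ?_)
  exact Set.inter_subset_inter_right _
    (Set.union_subset_union_left _ (Set.subset_sUnion_of_mem hA))

/-- The `k`-local strong `4`-core `S_k(G,v)`. -/
def localS (G : SimpleGraph V) (v : V) (k : ℕ) : Set V :=
  localCoreInner G v k ∪ sphere G v k

/-- `P_k(G,v)`. -/
def localP (G : SimpleGraph V) (v : V) (k : ℕ) : Set V :=
  extNbhd G (localS G v k \ sphere G v k) \ sphere G v k

/-- `R_k(G,v)`. -/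
def localR (G : SimpleGraph V) (v : V) (k : ℕ) : Set V :=
  ball G v k \ (localS G v k ∪ localP G v k)

/-- The vertex set of the connected component of `G[U]` containing `v` (empty if `v ∉ U`). -/
def componentIn (G : SimpleGraph V) (U : Set V) (v : V) : Set V :=
  {w | ∃ (hv : v ∈ U) (hw : w ∈ U), (G.induce U).Reachable ⟨v, hv⟩ ⟨w, hw⟩}

/-- `C_v^k(G)`, the component of `G[P_k(G,v) ∪ R_k(G,v)]` containing `v`. -/
def localC (G : SimpleGraph V) (v : V) (k : ℕ) : Set V :=
  componentIn G (localP G v k ∪ localR G v k) v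

/-- `F` is a family of `W`-paths in `H`: a set of vertex-disjoint paths (possibly of length `0`)
all of whose endpoints lie in `W`. -/
def IsPathFamily (H : SimpleGraph V) (W : Set V) (F : Set (Σ u v : V, H.Path u v)) : Prop :=
  (∀ q ∈ F, q.1 ∈ W ∧ q.2.1 ∈ W) ∧
    F.PairwiseDisjoint fun q => {x | x ∈ q.2.2.1.support}

/-- The vertices outside `W` that lie on no path of `F`. -/
def uncovered (H : SimpleGraph V) (W : Set V) (F : Set (Σ u v : V, H.Path u v)) : Set V :=
  {x | x ∉ W ∧ ∀ q ∈ F, x ∉ q.2.2.1.support}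

/-- `uc(H;W)` for a finite graph `H`: the least number of vertices outside `W` left uncovered by a
family of `W`-paths in `H`. -/
noncomputable def uc (H : SimpleGraph V) (W : Set V) : ℕ :=
  sInf {m | ∃ F, IsPathFamily H W F ∧ (uncovered H W F).ncard = m}

open Classical in
/-- `φ_{G,k}(v)`. -/
noncomputable def localPhi (G : SimpleGraph V) (k : ℕ) (v : V) : ℝ :=
  if v ∈ localS G v k then 0
  else (uc (G.induce (localC G v k)) {x | (x : V) ∈ localP G v k} : ℝ) / (localC G v k).ncard

/-- `L̃_k(G) = |V(G)| - ∑_v φ_{G,k}(v)`. -/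
noncomputable def localL [Fintype V] (k : ℕ) (G : SimpleGraph V) : ℝ :=
  (Fintype.card V : ℝ) - ∑ v : V, localPhi G k v

end LongCycle

/-!
The variance is bounded below through the correlation of `L̃_k` with the number `Y` of isolated
vertices. Write `p = c / n`, and `G - w` for the graph in which `w` has been isolated
(`deleteIncidenceSet`). Since `G - w` is independent of the event that `w` is isolated,
`Cov(L̃_k, Y) = -(1 - p) ^ (n - 1) * ∑ w, E[L̃_k(G) - L̃_k(G - w)]`, while
`Var Y ≤ n (1 - p) ^ (n - 1) (1 + c)`. By Cauchy-Schwarz it is enough that isolating a vertex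
decreases `L̃_k` by a constant on average (`le_expect_sub_sq`, `le_expect_sum_localL_sub`); the
resulting bound, of order `n e⁻²ᶜ / (1 + c)`, is far above the one required.

For the average decrease, the sum over `w` is exchanged with the sum over the vertices `v` in the
definition of `L̃_k`. The term `w = v` contributes `1 - φ(v)`, because `φ = 1` at an isolated
vertex. If `φ(v) = 0`, no other term is negative. So only the pairs `(v, w)` matter for which `v`
lies outside the local core and isolating `w` changes `φ(v)`.

By locality (`localPhi_congr`) such a `w` is in or next to the component of `v` outside the core,
formed in `G` or in `G - w`, or it changes the distance from `v` to a vertex in or next to this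
component, which is possible only if the component lies in a connected set of at least `k`
vertices. Maximality of the core shows that the component is contained in a connected set of which
at least a quarter of the vertices have no neighbours outside the set (`exists_closed_subset`).
Hence all relevant `w` touch a *pocket* at `v` (`IsPocket`, `exists_isPocket_of_localPhi_lt`), up
to at most `k` vertices on geodesics for each vertex touching a pocket with at least `k` vertices.

A union bound over the spanning trees of pockets (`prob_isPocket_le`) shows that, for `c ≥ 20` and
`k ≥ 100`, the expected number of relevant `w` in pockets with at most about `n / 100` vertices is
at most `7 / 10` (`sum_pocketTerm_le`). Larger pockets force a huge ball around `v`, which has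
probability of order `n⁻²` by a second moment bound (`prob_hasHugeBall_le`).
-/

namespace LongCycle

open SimpleGraph

/-! ### The local core and its complementary component -/

section Locality

variable {V : Type*} {G H : SimpleGraph V} {v w x y : V} {k : ℕ}

theorem edist_lt_of_mem_localCoreInner (hk : 1 ≤ k) (hx : x ∈ localCoreInner G v k) :
    G.edist v x < k := by
  have h : G.edist v x ≤ ((k - 1 : ℕ) : ℕ∞) := (isGreatest_localCoreInner G v k).1.1 hx
  exact h.trans_lt (by exact_mod_cast Nat.sub_lt hk one_pos)

theorem notMem_sphere_of_lt (h : G.edist v x < k) : x ∉ sphere G v k :=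
  fun h' => h.ne h'

theorem edist_le_pred_of_lt (h : G.edist v x < k) : G.edist v x ≤ ((k - 1 : ℕ) : ℕ∞) := by
  obtain ⟨m, hm⟩ := ENat.ne_top_iff_exists.1 (ne_top_of_lt h)
  rw [← hm] at h ⊢
  have : m < k := by exact_mod_cast h
  exact_mod_cast (by omega : m ≤ k - 1)

theorem edist_le_of_adj (hx : G.edist v x < k) (hxy : G.Adj x y) : G.edist v y ≤ k := by
  have h1 : G.edist v y ≤ G.edist v x + G.edist x y := SimpleGraph.edist_triangle
  rw [SimpleGraph.edist_eq_one_iff_adj.2 hxy] at h1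
  exact h1.trans (Order.add_one_le_of_lt hx)

theorem localS_sdiff_sphere (hk : 1 ≤ k) :
    localS G v k \ sphere G v k = localCoreInner G v k := by
  ext x
  simp only [localS, Set.mem_sdiff, Set.mem_union]
  have := fun h : x ∈ localCoreInner G v k =>
    notMem_sphere_of_lt (edist_lt_of_mem_localCoreInner hk h)
  tauto

theorem mem_localP_iff (hk : 1 ≤ k) :
    x ∈ localP G v k ↔ x ∉ localCoreInner G v k ∧ x ∉ sphere G v k ∧
      ∃ y ∈ localCoreInner G v k, G.Adj x y := by
  simp only [localP, localS_sdiff_sphere hk, extNbhd, Set.mem_sdiff, Set.mem_ofPred_eq]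
  tauto

theorem localP_union_localR (hk : 1 ≤ k) :
    localP G v k ∪ localR G v k = {x | G.edist v x < k ∧ x ∉ localCoreInner G v k} := by
  ext x
  simp only [Set.mem_union, mem_localP_iff hk, localR, localS, ball, Set.mem_sdiff,
    Set.mem_ofPred_eq, sphere]
  constructor
  · rintro (⟨h1, h2, y, hy, hxy⟩ | ⟨h1, h2⟩)
    · exact ⟨(edist_le_of_adj (edist_lt_of_mem_localCoreInner hk hy) hxy.symm).lt_of_ne h2, h1⟩
    · exact ⟨h1.lt_of_ne fun h => h2 (.inl (.inr h)), fun h => h2 (.inl (.inl h))⟩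
  · rintro ⟨h1, h2⟩
    by_cases h : ∃ y ∈ localCoreInner G v k, G.Adj x y
    · exact .inl ⟨h2, h1.ne, h⟩
    · exact .inr ⟨h1.le, by simp [h2, h1.ne, h]⟩

theorem componentIn_subset {U : Set V} : componentIn G U v ⊆ U := fun _ ⟨_, hw, _⟩ => hw

theorem mem_componentIn_self {U : Set V} (hv : v ∈ U) : v ∈ componentIn G U v :=
  ⟨hv, hv, .refl _⟩

theorem componentIn_adj {U : Set V} (hx : x ∈ componentIn G U v) (hy : y ∈ U)
    (hxy : G.Adj x y) : y ∈ componentIn G U v := by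
  obtain ⟨hv, hx, h⟩ := hx
  have hadj : (G.induce U).Adj ⟨x, hx⟩ ⟨y, hy⟩ := hxy
  exact ⟨hv, hy, h.trans hadj.reachable⟩

theorem componentIn_subset_of_closed {U T : Set V} (hv : v ∈ T)
    (hT : ∀ x ∈ T, ∀ y ∈ U, G.Adj x y → y ∈ T) : componentIn G U v ⊆ T := by
  rintro x ⟨hvU, hxU, ⟨p⟩⟩
  have key : ∀ (a b : U), (G.induce U).Walk a b → (a : V) ∈ T → (b : V) ∈ T := by
    intro a b p
    induction p with
    | nil => exact id
    | cons h _ ih => exact fun ha => ih (hT _ ha _ (Subtype.coe_prop _) h)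
  exact key _ _ p hv

theorem localC_subset (hk : 1 ≤ k) (hx : x ∈ localC G v k) :
    G.edist v x < k ∧ x ∉ localCoreInner G v k := by
  have := componentIn_subset hx
  rwa [localP_union_localR hk] at this

theorem mem_localC_self (hk : 1 ≤ k) (hv : v ∉ localS G v k) : v ∈ localC G v k := by
  refine mem_componentIn_self ?_
  rw [localP_union_localR hk]
  exact ⟨by simpa using (by omega : 0 < k), fun h => hv (.inl h)⟩

theorem mem_localC_of_adj (hk : 1 ≤ k) (hx : x ∈ localC G v k) (hxy : G.Adj x y) :
    y ∈ localC G v k ∨ y ∈ localCoreInner G v k ∪ sphere G v k := by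
  by_cases h : y ∈ localCoreInner G v k ∪ sphere G v k
  · exact .inr h
  · refine .inl (componentIn_adj hx ?_ hxy)
    rw [localP_union_localR hk]
    exact ⟨(edist_le_of_adj (localC_subset hk hx).1 hxy).lt_of_ne fun h' => h (.inr h'),
      fun h' => h (.inl h')⟩

/-- Maximality of the core, in the form in which it is used: a set `B` of vertices at distance
less than `k` is contained in the core, if every vertex of `B`, and every vertex outside the sphere
that is adjacent to `B`, has four neighbours in the core, the sphere or `B`, or is itself in or
next to the core. -/
theorem subset_localCoreInner_of_closed {B : Set V}
    (hB : ∀ x ∈ B, G.edist v x < k)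
    (hB' : ∀ x, (x ∈ B ∨ x ∉ sphere G v k ∧ ∃ y ∈ B, G.Adj x y) →
      x ∈ localCoreInner G v k ∪ extNbhd G (localCoreInner G v k) ∨
      4 ≤ (G.neighborSet x ∩ ((localCoreInner G v k ∪ B) ∪ sphere G v k)).encard) :
    B ⊆ localCoreInner G v k := by
  set A := localCoreInner G v k with hA
  obtain ⟨⟨hA1, hA2⟩, hmax⟩ := isGreatest_localCoreInner G v k
  refine Set.subset_union_right.trans (hmax (?_ : HasLocalCoreProperty G v k (A ∪ B)))
  refine ⟨Set.union_subset hA1 fun x hx => edist_le_pred_of_lt (hB x hx), ?_⟩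
  have mono : ∀ x, x ∈ A ∪ extNbhd G A → x ∉ sphere G v k →
      4 ≤ (G.neighborSet x ∩ ((A ∪ B) ∪ sphere G v k)).encard := fun x hx hxs =>
    (hA2 x ⟨hx, hxs⟩).trans (Set.encard_le_encard (Set.inter_subset_inter_right _
      (Set.union_subset_union_left _ Set.subset_union_left)))
  rintro x ⟨hx, hxs⟩
  have hx' : x ∈ A ∪ extNbhd G A ∨ (x ∈ B ∨ x ∉ sphere G v k ∧ ∃ y ∈ B, G.Adj x y) := by
    rcases hx with (hx | hx) | ⟨hx, y, hy | hy, hxy⟩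
    · exact .inl (.inl hx)
    · exact .inr (.inl hx)
    · exact .inl (.inr ⟨fun h => hx (.inl h), y, hy, hxy⟩)
    · exact .inr (.inr ⟨hxs, y, hy, hxy⟩)
  rcases hx' with h | h
  · exact mono x h hxs
  · exact (hB' x h).elim (fun h => mono x h hxs) id

/-- If `G` and `H` agree around the component `localC G v k`, and `H` keeps this component within
distance less than `k` of `v`, then the component avoids the core of `H` as well. -/
theorem localC_disjoint_localCoreInner (hk : 1 ≤ k)
    (hadj : ∀ x ∈ localC G v k, ∀ y, G.Adj x y ↔ H.Adj x y)
    (hdist : ∀ x ∈ localC G v k, H.edist v x < k) (hx : x ∈ localC G v k) :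
    x ∉ localCoreInner H v k := by
  set D := localC G v k with hD
  intro hxH
  refine (localC_subset hk hx).2 ?_
  suffices h : localCoreInner H v k ∩ D ⊆ localCoreInner G v k from h ⟨hxH, hx⟩
  have four : ∀ x ∈ D, x ∈ localCoreInner H v k ∪ extNbhd H (localCoreInner H v k) →
      4 ≤ (G.neighborSet x ∩ ((localCoreInner G v k ∪ (localCoreInner H v k ∩ D)) ∪
        sphere G v k)).encard := by
    intro x hx hxH
    refine ((isGreatest_localCoreInner H v k).1.2 x
      ⟨hxH, notMem_sphere_of_lt (hdist x hx)⟩).trans (Set.encard_le_encard ?_)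
    rintro y ⟨hxy, hy⟩
    have hxy' : G.Adj x y := (hadj x hx y).2 hxy
    refine ⟨hxy', ?_⟩
    rcases mem_localC_of_adj hk hx hxy' with h | h | h
    · exact .inl (.inr ⟨hy.resolve_right (notMem_sphere_of_lt (hdist y h)), h⟩)
    · exact .inl (.inl h)
    · exact .inr h
  refine subset_localCoreInner_of_closed (fun x hx => (localC_subset hk hx.2).1) ?_
  rintro x (hx | ⟨hxs, y, hy, hxy⟩)
  · exact .inr (four x hx.2 (.inl hx.1))
  · rcases mem_localC_of_adj hk hy.2 hxy.symm with h | h | h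
    · refine .inr (four x h ?_)
      by_cases hxH : x ∈ localCoreInner H v k
      · exact .inl hxH
      · exact .inr ⟨hxH, y, hy.1, (hadj x h y).1 hxy⟩
    · exact .inl (.inl h)
    · exact absurd h hxs

theorem localC_subset_of_agree (hk : 1 ≤ k)
    (hadj : ∀ x ∈ localC G v k, ∀ y, G.Adj x y ↔ H.Adj x y)
    (hdist : ∀ x ∈ localC G v k, H.edist v x < k) : localC G v k ⊆ localC H v k := by
  intro z hz
  have hv : v ∈ localC G v k := mem_componentIn_self hz.1
  have hU : ∀ x ∈ localC G v k, x ∈ localP H v k ∪ localR H v k := fun x hx => by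
    rw [localP_union_localR hk]
    exact ⟨hdist x hx, localC_disjoint_localCoreInner hk hadj hdist hx⟩
  have := componentIn_subset_of_closed (G := G) (U := localP G v k ∪ localR G v k)
    (T := localC G v k ∩ localC H v k) ⟨hv, mem_componentIn_self (hU v hv)⟩
    (fun x hx y hy hxy => by
      have hy' : y ∈ localC G v k := componentIn_adj hx.1 hy hxy
      exact ⟨hy', componentIn_adj hx.2 (hU y hy') ((hadj x hx.1 y).1 hxy)⟩)
  exact (this hz).2

theorem uc_induce_congr {D D' W W' : Set V} (hD : D = D')
    (hadj : ∀ x ∈ D, ∀ y ∈ D, G.Adj x y ↔ H.Adj x y) (hW : ∀ x ∈ D, x ∈ W ↔ x ∈ W') :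
    uc (G.induce D) {x | (x : V) ∈ W} = uc (H.induce D') {x | (x : V) ∈ W'} := by
  subst hD
  have h1 : G.induce D = H.induce D := by
    ext x y
    exact hadj x x.2 y y.2
  have h2 : {x : D | (x : V) ∈ W} = {x : D | (x : V) ∈ W'} := by
    ext x
    exact hW x x.2
  rw [h1, h2]

/-- Locality of `φ`: if the subgraph `H` of `G` agrees with `G` around both components of `v`, and
no vertex on or next to the component in `G` is pushed out to distance `k`, then `φ` takes the
same value at `v`. -/
theorem localPhi_congr (hk : 1 ≤ k) (hv : v ∉ localS G v k) (hle : H ≤ G)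
    (hG : ∀ x ∈ localC G v k, ∀ y, G.Adj x y → H.Adj x y)
    (hH : ∀ x ∈ localC H v k, ∀ y, G.Adj x y → H.Adj x y)
    (hdist : ∀ y, (y ∈ localC G v k ∨ ∃ x ∈ localC G v k, G.Adj x y) →
      G.edist v y < k → H.edist v y < k) :
    localPhi G k v = localPhi H k v := by
  have hG' : ∀ x ∈ localC G v k, ∀ y, G.Adj x y ↔ H.Adj x y :=
    fun x hx y => ⟨hG x hx y, fun h => hle h⟩
  have hH' : ∀ x ∈ localC H v k, ∀ y, H.Adj x y ↔ G.Adj x y :=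
    fun x hx y => ⟨fun h => hle h, hH x hx y⟩
  have hdG : ∀ x ∈ localC G v k, H.edist v x < k :=
    fun x hx => hdist x (.inl hx) (localC_subset hk hx).1
  have hdH : ∀ x, H.edist v x < k → G.edist v x < k :=
    fun x hx => (SimpleGraph.edist_anti hle).trans_lt hx
  have hC : localC G v k = localC H v k :=
    (localC_subset_of_agree hk hG' hdG).antisymm
      (localC_subset_of_agree hk hH' fun x hx => hdH x (localC_subset hk hx).1)
  have hv' : v ∉ localS H v k := by
    have h := mem_localC_self hk hv
    rintro (h' | h')
    · exact localC_disjoint_localCoreInner hk hG' hdG h h'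
    · exact notMem_sphere_of_lt (hdG v h) h'
  have hP : ∀ x ∈ localC G v k, x ∈ localP G v k ↔ x ∈ localP H v k := by
    intro x hx
    have hxH : x ∈ localC H v k := hC ▸ hx
    rw [mem_localP_iff hk, mem_localP_iff hk]
    have h1 := localC_subset hk hx
    have h2 := localC_subset hk hxH
    constructor
    · rintro ⟨-, -, y, hy, hxy⟩
      refine ⟨h2.2, notMem_sphere_of_lt h2.1, y, ?_, hG x hx y hxy⟩
      have hd := hdist y (.inr ⟨x, hx, hxy⟩) (edist_lt_of_mem_localCoreInner hk hy)
      rcases mem_localC_of_adj hk hxH (hG x hx y hxy) with h | h | h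
      · exact absurd hy (localC_subset hk (hC ▸ h : y ∈ localC G v k)).2
      · exact h
      · exact absurd h (notMem_sphere_of_lt hd)
    · rintro ⟨-, -, y, hy, hxy⟩
      refine ⟨h1.2, notMem_sphere_of_lt h1.1, y, ?_, hle hxy⟩
      have hd := hdH y (edist_lt_of_mem_localCoreInner hk hy)
      rcases mem_localC_of_adj hk hx (hle hxy) with h | h | h
      · exact absurd hy (localC_subset hk (hC ▸ h : y ∈ localC H v k)).2
      · exact h
      · exact absurd h (notMem_sphere_of_lt hd)
  rw [localPhi, localPhi, if_neg hv, if_neg hv',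
    uc_induce_congr hC (fun x hx y _ => hG' x hx y) hP, hC]

end Locality

/-! ### Bounds for `φ` -/

section Bounds

variable {V : Type*} {G : SimpleGraph V} {v w x y : V} {k : ℕ}

theorem uc_le_card [Finite V] (H : SimpleGraph V) (W : Set V) : uc H W ≤ Nat.card V := by
  have h : uc H W ≤ (uncovered H W ∅).ncard := Nat.sInf_le ⟨∅, ⟨by simp, by simp⟩, rfl⟩
  rw [← Set.ncard_univ]
  exact h.trans (Set.ncard_le_ncard (Set.subset_univ _))

theorem localPhi_nonneg : 0 ≤ localPhi G k v := by
  unfold localPhi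
  split_ifs <;> positivity

theorem localPhi_le_one [Finite V] : localPhi G k v ≤ 1 := by
  unfold localPhi
  split_ifs
  · exact zero_le_one
  · refine div_le_one_of_le₀ ?_ (by positivity)
    exact_mod_cast uc_le_card _ _

/-- Paths with both ends in `∅` do not exist, so nothing is covered. -/
theorem uc_empty (H : SimpleGraph V) : uc H ∅ = Nat.card V := by
  unfold uc
  have : {m | ∃ F, IsPathFamily H ∅ F ∧ (uncovered H ∅ F).ncard = m} = {Nat.card V} := by
    ext m
    simp only [Set.mem_ofPred_eq, Set.mem_singleton_iff]
    have hu : ∀ F, IsPathFamily H ∅ F → (uncovered H ∅ F).ncard = Nat.card V := by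
      intro F hF
      rw [← Set.ncard_univ]
      congr 1
      ext x
      simp only [uncovered, Set.mem_ofPred_eq, Set.mem_univ, iff_true]
      exact ⟨id, fun q hq => absurd (hF.1 q hq).1 (by simp)⟩
    constructor
    · rintro ⟨F, hF, rfl⟩
      exact hu F hF
    · rintro rfl
      exact ⟨∅, ⟨by simp, by simp⟩, hu _ ⟨by simp, by simp⟩⟩
  rw [this, csInf_singleton]

theorem localPhi_of_isolated (hk : 1 ≤ k) (hv : ∀ y, ¬ G.Adj v y) : localPhi G k v = 1 := by
  have hA : ∀ x, x ∈ localCoreInner G v k → ∃ y, G.Adj x y := by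
    intro x hx
    have h := (isGreatest_localCoreInner G v k).1.2 x
      ⟨.inl hx, notMem_sphere_of_lt (edist_lt_of_mem_localCoreInner hk hx)⟩
    have h0 : (G.neighborSet x ∩ (localCoreInner G v k ∪ sphere G v k)).encard ≠ 0 := by
      intro h0
      rw [h0] at h
      simp at h
    obtain ⟨y, hy, -⟩ := Set.encard_ne_zero.1 h0
    exact ⟨y, hy⟩
  have hvA : v ∉ localCoreInner G v k := fun h => (hA v h).elim hv
  have hd : G.edist v v < k := by simpa using (by omega : 0 < k)
  have hvS : v ∉ localS G v k := by
    rintro (h | h)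
    · exact hvA h
    · exact notMem_sphere_of_lt hd h
  have hC : localC G v k = {v} := by
    refine Set.Subset.antisymm (componentIn_subset_of_closed rfl ?_) ?_
    · rintro x rfl y - hxy
      exact absurd hxy (hv y)
    · rintro x rfl
      exact mem_localC_self hk hvS
  have hW : {x : localC G v k | (x : V) ∈ localP G v k} = ∅ := by
    ext ⟨x, hx⟩
    simp only [Set.mem_ofPred_eq, Set.mem_empty_iff_false, iff_false, mem_localP_iff hk]
    rintro ⟨-, -, y, -, hxy⟩
    rw [hC] at hx
    obtain rfl : x = v := hx
    exact hv y hxy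
  rw [localPhi, if_neg hvS, hW, uc_empty, Nat.card_coe_set_eq, div_self]
  rw [hC]
  simp

end Bounds

/-! ### Pockets: small connected sets with few neighbours outside -/

section Pockets

variable {V : Type*} {G H : SimpleGraph V} {v w x y : V} {k : ℕ}

/-- The closed neighbourhood of a finite set of vertices. -/
noncomputable def closedNbhd [Fintype V] (G : SimpleGraph V) (Q : Finset V) : Finset V :=
  open Classical in Finset.univ.filter fun x => x ∈ Q ∨ ∃ q ∈ Q, G.Adj q x

theorem mem_closedNbhd [Fintype V] {Q : Finset V} :
    x ∈ closedNbhd G Q ↔ x ∈ Q ∨ ∃ q ∈ Q, G.Adj q x := by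
  simp [closedNbhd]

/-- Adding to `Q` a vertex with at most three neighbours outside the closed neighbourhood of `Q`
enlarges this neighbourhood by at most four vertices. -/
theorem card_closedNbhd_insert_le [Fintype V] [DecidableEq V] {Q : Finset V} {T : Set V}
    (hT : ∀ y, G.Adj x y → y ∈ closedNbhd G Q ∨ y ∈ T)
    (hx : ¬ 4 ≤ (G.neighborSet x ∩ T).encard) :
    (closedNbhd G (insert x Q)).card ≤ (closedNbhd G Q).card + 4 := by
  classical
  set F : Finset V := Finset.univ.filter fun y => G.Adj x y ∧ y ∈ T with hF
  have hFc : F.card ≤ 3 := by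
    have h1 : (G.neighborSet x ∩ T) = (F : Set V) := by
      ext y
      simp [hF]
    rw [h1, Set.encard_coe_eq_coe_finsetCard] at hx
    have : ¬ 4 ≤ F.card := fun h => hx (by exact_mod_cast h)
    omega
  have hsub : closedNbhd G (insert x Q) ⊆ closedNbhd G Q ∪ insert x F := by
    intro y hy
    simp only [Finset.mem_union, Finset.mem_insert, hF, Finset.mem_filter, Finset.mem_univ,
      true_and]
    simp only [mem_closedNbhd, Finset.mem_insert] at hy
    rcases hy with (rfl | hy) | ⟨q, rfl | hq, hqy⟩
    · exact .inr (.inl rfl)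
    · exact .inl (mem_closedNbhd.2 (.inl hy))
    · rcases hT y hqy with h | h
      · exact .inl h
      · exact .inr (.inr ⟨hqy, h⟩)
    · exact .inl (mem_closedNbhd.2 (.inr ⟨q, hq, hqy⟩))
  have h2 := (Finset.card_le_card hsub).trans (Finset.card_union_le _ _)
  have h3 := Finset.card_insert_le x F
  omega

/-- The component of a vertex outside the core lies in a connected set `X` of which at least a
quarter of the vertices, those in `Q`, have no neighbours outside `X`. The set `Q` is a maximal
subset of the component whose closed neighbourhood has at most `4 * |Q|` elements: vertices of the
component missed by this neighbourhood could be added to the core. -/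
theorem exists_closed_subset [Fintype V] (hk : 1 ≤ k) (hv : v ∉ localS G v k) :
    ∃ X Q : Finset V, Q.Nonempty ∧ Q ⊆ X ∧ X.card ≤ 4 * Q.card ∧
      (∀ q ∈ Q, ∀ y, G.Adj q y → y ∈ X) ∧ (∀ x ∈ X, x ∈ componentIn G X v) ∧
      (localC G v k ⊆ X) ∧ (↑Q ⊆ localC G v k) ∧ ∀ x ∈ X, G.edist v x ≤ k := by
  classical
  set D := localC G v k with hD
  obtain ⟨Q, hQ, hmax⟩ := Finset.exists_max_image
    (Finset.univ.filter fun Q : Finset V => ↑Q ⊆ D ∧ (closedNbhd G Q).card ≤ 4 * Q.card)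
    Finset.card
    ⟨∅, Finset.mem_filter.2 ⟨Finset.mem_univ _, by simp, by simp [closedNbhd]⟩⟩
  simp only [Finset.mem_filter, Finset.mem_univ, true_and] at hQ hmax
  obtain ⟨hQD, hQc⟩ := hQ
  have hdis : ∀ x ∈ D, x ∉ localCoreInner G v k := fun x hx => (localC_subset hk hx).2
  set B : Set V := D \ closedNbhd G Q with hB
  have four : ∀ x ∈ D, x ∉ Q →
      4 ≤ (G.neighborSet x ∩ ((localCoreInner G v k ∪ B) ∪ sphere G v k)).encard := by
    intro x hx hxQ
    by_contra hcon
    have h1 := card_closedNbhd_insert_le (Q := Q) (x := x) (G := G) (fun y hxy => by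
      by_cases hy : y ∈ closedNbhd G Q
      · exact .inl hy
      · rcases mem_localC_of_adj hk hx hxy with h | h | h
        · exact .inr (.inl (.inr ⟨h, hy⟩))
        · exact .inr (.inl (.inl h))
        · exact .inr (.inr h)) hcon
    have h2 := hmax (insert x Q) ⟨by
      intro z hz
      rcases Finset.mem_insert.1 (Finset.mem_coe.1 hz) with rfl | hz
      · exact hx
      · exact hQD hz, by rw [Finset.card_insert_of_notMem hxQ]; omega⟩
    rw [Finset.card_insert_of_notMem hxQ] at h2
    omega
  have hBA : B ⊆ localCoreInner G v k := by
    refine subset_localCoreInner_of_closed (fun x hx => (localC_subset hk hx.1).1) ?_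
    rintro x (hx | ⟨hxs, y, hy, hxy⟩)
    · exact .inr (four x hx.1 fun h => hx.2 (mem_closedNbhd.2 (.inl h)))
    · rcases mem_localC_of_adj hk hy.1 hxy.symm with h | h | h
      · exact .inr (four x h fun h' => hy.2 (mem_closedNbhd.2 (.inr ⟨x, h', hxy⟩)))
      · exact .inl (.inl h)
      · exact absurd h hxs
  have hDX : D ⊆ closedNbhd G Q := by
    intro x hx
    by_contra h
    exact hdis x hx (hBA ⟨hx, h⟩)
  have hvD : v ∈ D := mem_localC_self hk hv
  have hQX : Q ⊆ closedNbhd G Q := fun x hx => mem_closedNbhd.2 (.inl hx)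
  have hDconn : ∀ x ∈ D, x ∈ componentIn G (closedNbhd G Q) v := by
    intro x hx
    have h := componentIn_subset_of_closed (G := G) (U := localP G v k ∪ localR G v k)
      (T := D ∩ componentIn G (closedNbhd G Q) v) ⟨hvD, mem_componentIn_self (hDX hvD)⟩
      fun x hx y hy hxy =>
        have hy' : y ∈ D := componentIn_adj hx.1 hy hxy
        ⟨hy', componentIn_adj hx.2 (hDX hy') hxy⟩
    exact (h hx).2
  refine ⟨closedNbhd G Q, Q, ?_, hQX, hQc,
    fun q hq y hqy => mem_closedNbhd.2 (.inr ⟨q, hq, hqy⟩), ?_, hDX, hQD, ?_⟩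
  · rcases mem_closedNbhd.1 (hDX hvD) with h | ⟨q, hq, -⟩
    exacts [⟨_, h⟩, ⟨q, hq⟩]
  · intro x hx
    rcases mem_closedNbhd.1 hx with h | ⟨q, hq, hqx⟩
    · exact hDconn x (hQD h)
    · exact componentIn_adj (hDconn q (hQD hq)) hx hqx
  · intro x hx
    rcases mem_closedNbhd.1 hx with h | ⟨q, hq, hqx⟩
    · exact (localC_subset hk (hQD h)).1.le
    · exact edist_le_of_adj (localC_subset hk (hQD hq)).1 hqx

/-- A pocket at `v` touching `w`: a connected set `X` containing `v`, of which at least a quarter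
of the vertices, those in `Q`, have no neighbours outside `X` other than `w`, where `w` is in `X`
or adjacent to `X`. -/
structure IsPocket (G : SimpleGraph V) (v w : V) (X Q : Finset V) : Prop where
  nonempty : Q.Nonempty
  subset : Q ⊆ X
  card_le : X.card ≤ 4 * Q.card
  closed : ∀ q ∈ Q, ∀ y, G.Adj q y → y ∈ X ∨ y = w
  connected : ∀ x ∈ X, x ∈ componentIn G X v
  touches : w ∈ X ∨ ∃ x ∈ X, G.Adj x w

theorem IsPocket.mem {X Q : Finset V} (h : IsPocket G v w X Q) : v ∈ X := by
  obtain ⟨q, hq⟩ := h.nonempty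
  exact (h.connected q (h.subset hq)).1

theorem componentIn_mono_graph (hle : H ≤ G) {U : Set V} : componentIn H U v ⊆ componentIn G U v := by
  rintro x hx
  exact componentIn_subset_of_closed (mem_componentIn_self hx.1)
    (fun x hx y hy hxy => componentIn_adj hx hy (hle hxy)) hx

theorem edist_lt_card_of_mem_componentIn {X : Finset V} (hx : x ∈ componentIn G X v) :
    G.edist v x < X.card := by
  classical
  obtain ⟨hv, hx, hr⟩ := hx
  obtain ⟨p, hp⟩ := hr.exists_isPath
  have h1 : p.length < X.card := by simpa using hp.length_lt
  refine (SimpleGraph.edist_le (p.map (Embedding.induce (X : Set V)).toHom)).trans_lt ?_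
  rw [Walk.length_map]
  exact_mod_cast h1

theorem notMem_localS_of_mem_localC (hk : 1 ≤ k) (hx : x ∈ localC G v k) : v ∉ localS G v k := by
  have hv := localC_subset hk (mem_componentIn_self hx.1 : v ∈ localC G v k)
  rintro (h | h)
  exacts [hv.2 h, notMem_sphere_of_lt hv.1 h]

/-- If isolating `w` decreases `φ` at `v`, where the value at `v = w` itself is expected to
increase by one, then there is a pocket at `v` touching `w`, or a large pocket at `v` touching a
vertex whose distance from `v` changes because of `w`. -/
theorem exists_isPocket_of_localPhi_lt [Fintype V] [DecidableEq V] (hk : 1 ≤ k)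
    (h : localPhi (G.deleteIncidenceSet w) k v - localPhi G k v < if w = v then 1 else 0) :
    (∃ X Q, IsPocket G v w X Q ∧ ∀ x ∈ X, G.edist v x ≤ k) ∨
    ∃ y X Q, IsPocket G v y X Q ∧ (∀ x ∈ X, G.edist v x ≤ k) ∧ k ≤ X.card ∧
      G.edist v y < k ∧ ¬ (G.deleteIncidenceSet w).edist v y < k := by
  set H := G.deleteIncidenceSet w with hH
  have hle : H ≤ G := G.deleteIncidenceSet_le w
  have hvS : v ∉ localS G v k := by
    intro hv
    have h0 : localPhi G k v = 0 := by rw [localPhi, if_pos hv]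
    rw [h0, sub_zero] at h
    split_ifs at h with hwv
    · subst hwv
      rw [localPhi_of_isolated hk (by simp [hH, deleteIncidenceSet_adj])] at h
      exact lt_irrefl _ h
    · exact h.not_ge localPhi_nonneg
  obtain ⟨X, Q, hQ, hQX, hc, hcl, hconn, hDX, hQD, hball⟩ := exists_closed_subset hk hvS
  have hvD := mem_localC_self hk hvS
  have pocket : ∀ y, (y ∈ X ∨ ∃ x ∈ X, G.Adj x y) → IsPocket G v y X Q := fun y hy =>
    ⟨hQ, hQX, hc, fun q hq z hz => .inl (hcl q hq z hz), hconn, hy⟩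
  by_cases hwv : w = v
  · exact .inl ⟨X, Q, pocket w (.inl (hwv ▸ hDX hvD)), hball⟩
  rw [if_neg hwv] at h
  by_cases hw1 : w ∈ localC G v k ∨ ∃ x ∈ localC G v k, G.Adj x w
  · refine .inl ⟨X, Q, pocket w ?_, hball⟩
    exact hw1.imp (fun h => hDX h) fun ⟨x, hx, hxw⟩ => ⟨x, hDX hx, hxw⟩
  have hwD : w ∉ localC H v k := by
    intro hw
    have := componentIn_subset_of_closed (G := H) (U := localP H v k ∪ localR H v k)
      (T := {w}ᶜ) (v := v) (Ne.symm hwv) fun x hx y _ hxy => by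
        rw [hH, deleteIncidenceSet_adj] at hxy
        exact hxy.2.2
    exact this hw rfl
  by_cases hw2 : ∃ x ∈ localC H v k, G.Adj x w
  · left
    obtain ⟨x, hx, hxw⟩ := hw2
    obtain ⟨X, Q, hQ, hQX, hc, hcl, hconn, hDX, hQD, hball⟩ :=
      exists_closed_subset hk (notMem_localS_of_mem_localC hk hx)
    refine ⟨X, Q, ⟨hQ, hQX, hc, fun q hq y hqy => ?_,
      fun x hx => componentIn_mono_graph hle (hconn x hx), .inr ⟨x, hDX hx, hxw⟩⟩,
      fun x hx => (SimpleGraph.edist_anti hle).trans (hball x hx)⟩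
    by_cases hyw : y = w
    · exact .inr hyw
    · refine .inl (hcl q hq y ?_)
      rw [hH, deleteIncidenceSet_adj]
      exact ⟨hqy, fun hqw => hwD (hqw ▸ hQD hq), hyw⟩
  push Not at hw1 hw2
  have hG : ∀ x ∈ localC G v k, ∀ y, G.Adj x y → H.Adj x y := fun x hx y hxy => by
    rw [hH, deleteIncidenceSet_adj]
    exact ⟨hxy, fun hxw => hw1.1 (hxw ▸ hx), fun hyw => hw1.2 x hx (hyw ▸ hxy)⟩
  have hHa : ∀ x ∈ localC H v k, ∀ y, G.Adj x y → H.Adj x y := fun x hx y hxy => by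
    rw [hH, deleteIncidenceSet_adj]
    exact ⟨hxy, fun hxw => hwD (hxw ▸ hx), fun hyw => hw2 x hx (hyw ▸ hxy)⟩
  by_cases hdist : ∀ y, (y ∈ localC G v k ∨ ∃ x ∈ localC G v k, G.Adj x y) →
      G.edist v y < k → H.edist v y < k
  · rw [localPhi_congr hk hvS hle hG hHa hdist, sub_self] at h
    exact absurd h (lt_irrefl _)
  push Not at hdist
  obtain ⟨y, hy, hy1, hy2⟩ := hdist
  refine .inr ⟨y, X, Q, pocket y (hy.imp (fun h => hDX h) fun ⟨x, hx, hxw⟩ => ⟨x, hDX hx, hxw⟩),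
    hball, ?_, hy1, hy2.not_gt⟩
  -- In a small pocket all relevant distances are realised inside the component.
  by_contra hlt
  have hDd : ∀ x ∈ localC G v k, H.edist v x < X.card := by
    intro x hx
    have h := componentIn_subset_of_closed (G := G) (U := localP G v k ∪ localR G v k)
      (T := localC G v k ∩ componentIn H X v) ⟨hvD, mem_componentIn_self (hDX hvD)⟩
      fun x hx y hy hxy =>
        have hy' : y ∈ localC G v k := componentIn_adj hx.1 hy hxy
        ⟨hy', componentIn_adj hx.2 (hDX hy') (hG x hx.1 y hxy)⟩
    exact edist_lt_card_of_mem_componentIn (h hx).2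
  have hlt' : (X.card : ℕ∞) < k := by exact_mod_cast not_le.1 hlt
  rcases hy with hy | ⟨x, hx, hxy⟩
  · exact hy2.not_gt ((hDd y hy).trans hlt')
  · exact hy2.not_gt ((edist_le_of_adj (hDd x hx) (hG x hx y hxy)).trans_lt hlt')

/-- Few vertices are essential for a given vertex to be within a given distance. -/
theorem card_edist_critical_le [Fintype V] [DecidableEq V] (v y : V) (k : ℕ) (S : Finset V)
    (hS : ∀ w ∈ S, G.edist v y < k ∧ ¬ (G.deleteIncidenceSet w).edist v y < k) :
    S.card ≤ k := by
  rcases S.eq_empty_or_nonempty with rfl | ⟨w, hw⟩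
  · simp
  have hlt := (hS w hw).1
  obtain ⟨p, hp⟩ := SimpleGraph.exists_walk_of_edist_ne_top (ne_top_of_lt hlt)
  have hpk : p.length < k := by
    rw [← hp] at hlt
    exact_mod_cast hlt
  have hsub : S ⊆ p.support.toFinset := by
    intro u hu
    by_contra hus
    rw [List.mem_toFinset] at hus
    refine (hS u hu).2 ?_
    have hedge : ∀ e ∈ p.edges, e ∈ (G.deleteIncidenceSet u).edgeSet := by
      intro e he
      induction e with | _ a b
      rw [SimpleGraph.mem_edgeSet, deleteIncidenceSet_adj]
      exact ⟨p.adj_of_mem_edges he, fun h => hus (h ▸ p.fst_mem_support_of_mem_edges he),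
        fun h => hus (h ▸ p.snd_mem_support_of_mem_edges he)⟩
    refine (SimpleGraph.edist_le (p.transfer _ hedge)).trans_lt ?_
    rw [Walk.length_transfer]
    exact_mod_cast hpk
  have h1 := (Finset.card_le_card hsub).trans p.support.toFinset_card_le
  rw [Walk.length_support] at h1
  omega

end Pockets

/-! ### Counting the vertices that influence `φ` -/

section Counting

variable {V : Type*} {G : SimpleGraph V} {v : V} {k : ℕ}

/-- The number of pairs consisting of a vertex `w` and a small pocket at `v` touching `w`, where
pockets with at least `k` vertices are counted `k + 1` times. -/
noncomputable def pocketCount [Fintype V] (G : SimpleGraph V) (k : ℕ) (v : V) : ℝ :=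
  open Classical in
  ∑ w : V, ∑ X : Finset V, ∑ Q : Finset V,
    if 100 * (X.card + 1) ≤ Fintype.card V ∧ IsPocket G v w X Q then
      (1 + if k ≤ X.card then (k : ℝ) else 0) else 0

/-- The ball of radius `k` contains at least about a hundredth of the vertices. -/
def HasHugeBall [Fintype V] (G : SimpleGraph V) (k : ℕ) (v : V) : Prop :=
  Fintype.card V < 100 * ((ball G v k).ncard + 1)

theorem pocketCount_nonneg [Fintype V] : 0 ≤ pocketCount G k v := by
  classical
  refine Finset.sum_nonneg fun w _ => Finset.sum_nonneg fun X _ => Finset.sum_nonneg fun Q _ => ?_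
  split_ifs <;> positivity

open Classical in
/-- The total change of `φ` at `v` when single vertices are isolated. The term `1` comes from
isolating `v` itself, and each other vertex whose isolation decreases `φ` at `v` is accounted for by
a pocket, unless the ball around `v` is huge. -/
theorem le_sum_localPhi_sub [Fintype V] (hk : 1 ≤ k) (G : SimpleGraph V) (v : V) :
    1 - pocketCount G k v -
        (if HasHugeBall G k v then (Fintype.card V : ℝ) * (1 + k) else 0) ≤
      ∑ w, (localPhi (G.deleteIncidenceSet w) k v - localPhi G k v) := by
  have hone : ∑ w : V, (if w = v then (1 : ℝ) else 0) = 1 := by simp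
  have hterm : ∀ w, (if w = v then (1 : ℝ) else 0) - 1 ≤
      localPhi (G.deleteIncidenceSet w) k v - localPhi G k v := by
    intro w
    have h1 : localPhi G k v ≤ 1 := localPhi_le_one
    split_ifs with h
    · subst h
      rw [localPhi_of_isolated hk (by simp [deleteIncidenceSet_adj])]
      linarith
    · linarith [localPhi_nonneg (G := G.deleteIncidenceSet w) (k := k) (v := v)]
  split_ifs with hb
  · have h1 := Finset.sum_le_sum fun w (_ : w ∈ Finset.univ) => hterm w
    rw [Finset.sum_sub_distrib, hone] at h1
    simp only [Finset.sum_const, Finset.card_univ, nsmul_eq_mul, mul_one] at h1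
    have h2 : 0 ≤ (Fintype.card V : ℝ) * k := by positivity
    linarith [pocketCount_nonneg (G := G) (k := k) (v := v)]
  rw [sub_zero]
  have hsmall : ∀ X : Finset V, (∀ x ∈ X, G.edist v x ≤ k) →
      100 * (X.card + 1) ≤ Fintype.card V := by
    intro X hX
    have h1 : X.card ≤ (ball G v k).ncard := by
      rw [← Set.ncard_coe_finset]
      exact Set.ncard_le_ncard fun x hx => hX x hx
    unfold HasHugeBall at hb
    omega
  set P1 : V → Prop := fun w => ∃ X Q, IsPocket G v w X Q ∧ ∀ x ∈ X, G.edist v x ≤ k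
  set P2 : V → Prop := fun y => ∃ X Q, IsPocket G v y X Q ∧ (∀ x ∈ X, G.edist v x ≤ k) ∧ k ≤ X.card
  set cr : V → V → Prop := fun y w => G.edist v y < k ∧ ¬ (G.deleteIncidenceSet w).edist v y < k
  have hind : ∀ w, (if w = v then (1 : ℝ) else 0) - (if P1 w then 1 else 0) -
      (∑ y, if P2 y ∧ cr y w then 1 else 0) ≤
      localPhi (G.deleteIncidenceSet w) k v - localPhi G k v := by
    intro w
    have hs : (0 : ℝ) ≤ ∑ y, if P2 y ∧ cr y w then (1 : ℝ) else 0 :=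
      Finset.sum_nonneg fun y _ => by split_ifs <;> norm_num
    by_cases h : localPhi (G.deleteIncidenceSet w) k v - localPhi G k v < if w = v then 1 else 0
    · rcases exists_isPocket_of_localPhi_lt hk h with h1 | ⟨y, X, Q, h1, h2, h3, h4⟩
      · rw [if_pos (show P1 w from h1)]
        linarith [hterm w]
      · have h5 : (1 : ℝ) ≤ ∑ y, if P2 y ∧ cr y w then (1 : ℝ) else 0 := by
          have h6 := Finset.single_le_sum (f := fun y => if P2 y ∧ cr y w then (1 : ℝ) else 0)
            (fun y _ => by split_ifs <;> norm_num) (Finset.mem_univ y)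
          have h7 : P2 y ∧ cr y w := ⟨⟨X, Q, h1, h2, h3⟩, h4⟩
          simp only [if_pos h7] at h6
          exact h6
        have h6 : (0 : ℝ) ≤ if P1 w then 1 else 0 := by split_ifs <;> norm_num
        linarith [hterm w]
    · have h6 : (0 : ℝ) ≤ if P1 w then 1 else 0 := by split_ifs <;> norm_num
      linarith [not_lt.1 h]
  have hcrit : ∑ w, ∑ y, (if P2 y ∧ cr y w then (1 : ℝ) else 0) ≤
      ∑ y, if P2 y then (k : ℝ) else 0 := by
    rw [Finset.sum_comm]
    refine Finset.sum_le_sum fun y _ => ?_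
    split_ifs with h
    · simp only [h, true_and]
      rw [Finset.sum_boole]
      exact_mod_cast card_edist_critical_le v y k _ fun w hw => (Finset.mem_filter.1 hw).2
    · simp [h]
  have hpc : ∑ w, ((if P1 w then (1 : ℝ) else 0) + if P2 w then (k : ℝ) else 0) ≤
      pocketCount G k v := by
    refine Finset.sum_le_sum fun w _ => ?_
    have hnn : ∀ X Q : Finset V, (0 : ℝ) ≤
        if 100 * (X.card + 1) ≤ Fintype.card V ∧ IsPocket G v w X Q then
          (1 + if k ≤ X.card then (k : ℝ) else 0) else 0 := fun X Q => by
      split_ifs <;> positivity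
    have hsingle : ∀ X Q : Finset V, IsPocket G v w X Q → (∀ x ∈ X, G.edist v x ≤ k) →
        (1 + if k ≤ X.card then (k : ℝ) else 0) ≤ ∑ X : Finset V, ∑ Q : Finset V,
          if 100 * (X.card + 1) ≤ Fintype.card V ∧ IsPocket G v w X Q then
            (1 + if k ≤ X.card then (k : ℝ) else 0) else 0 := by
      intro X Q h1 h2
      refine le_trans ?_ ((Finset.single_le_sum (fun Q _ => hnn X Q) (Finset.mem_univ Q)).trans
        (Finset.single_le_sum (f := fun X => ∑ Q : Finset V,
          if 100 * (X.card + 1) ≤ Fintype.card V ∧ IsPocket G v w X Q then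
            (1 + if k ≤ X.card then (k : ℝ) else 0) else 0)
          (fun X _ => Finset.sum_nonneg fun Q _ => hnn X Q) (Finset.mem_univ X)))
      exact (if_pos (And.intro (hsmall X h2) h1)).ge
    by_cases h2 : P2 w
    · obtain ⟨X, Q, hp, hX, hkX⟩ := id h2
      have h3 := hsingle X Q hp hX
      rw [if_pos hkX] at h3
      rw [if_pos h2]
      refine le_trans ?_ h3
      gcongr
      split_ifs <;> norm_num
    · rw [if_neg h2, add_zero]
      split_ifs with h1
      · obtain ⟨X, Q, hp, hX⟩ := h1
        refine le_trans ?_ (hsingle X Q hp hX)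
        have : (0 : ℝ) ≤ if k ≤ X.card then (k : ℝ) else 0 := by positivity
        linarith
      · exact Finset.sum_nonneg fun X _ => Finset.sum_nonneg fun Q _ => hnn X Q
  have hsum := Finset.sum_le_sum fun w (_ : w ∈ Finset.univ) => hind w
  rw [Finset.sum_sub_distrib, Finset.sum_sub_distrib, hone] at hsum
  rw [Finset.sum_add_distrib] at hpc
  linarith

end Counting

/-! ### Expectations over the binomial random graph as finite sums -/

section Probability

variable {V : Type*} {p : ℝ}

/-- The probability of the graph `G` in the binomial random graph with edge probability `p`. -/
noncomputable def weight [Fintype V] (p : ℝ) (G : SimpleGraph V) : ℝ :=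
  p ^ G.edgeSet.ncard * (1 - p) ^ ((Fintype.card V).choose 2 - G.edgeSet.ncard)

theorem weight_nonneg [Fintype V] (h0 : 0 ≤ p) (h1 : p ≤ 1) (G : SimpleGraph V) : 0 ≤ weight p G := by
  have : 0 ≤ 1 - p := by linarith
  unfold weight
  positivity

variable [Fintype V] [DecidableEq V]

/-- The expectation of `F` over the binomial random graph with edge probability `p`. -/
noncomputable def expect (p : ℝ) (F : SimpleGraph V → ℝ) : ℝ := ∑ G, weight p G * F G

open Classical in
/-- The probability of `P` in the binomial random graph with edge probability `p`. -/
noncomputable def prob (p : ℝ) (P : SimpleGraph V → Prop) : ℝ :=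
  expect p fun G => if P G then 1 else 0

theorem expect_mono (h0 : 0 ≤ p) (h1 : p ≤ 1) {F F' : SimpleGraph V → ℝ} (h : ∀ G, F G ≤ F' G) :
    expect p F ≤ expect p F' :=
  Finset.sum_le_sum fun G _ => mul_le_mul_of_nonneg_left (h G) (weight_nonneg h0 h1 G)

theorem expect_sum {ι : Type*} (s : Finset ι) (F : ι → SimpleGraph V → ℝ) :
    expect p (fun G => ∑ i ∈ s, F i G) = ∑ i ∈ s, expect p (F i) := by
  simp only [expect, Finset.mul_sum]
  exact Finset.sum_comm

theorem expect_sub (F F' : SimpleGraph V → ℝ) :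
    expect p (fun G => F G - F' G) = expect p F - expect p F' := by
  simp [expect, mul_sub]

theorem expect_add (F F' : SimpleGraph V → ℝ) :
    expect p (fun G => F G + F' G) = expect p F + expect p F' := by
  simp [expect, mul_add, Finset.sum_add_distrib]

theorem expect_const_mul (a : ℝ) (F : SimpleGraph V → ℝ) :
    expect p (fun G => a * F G) = a * expect p F := by
  simp only [expect, Finset.mul_sum]
  exact Finset.sum_congr rfl fun G _ => by ring

theorem prob_mono (h0 : 0 ≤ p) (h1 : p ≤ 1) {P P' : SimpleGraph V → Prop} (h : ∀ G, P G → P' G) :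
    prob p P ≤ prob p P' :=
  expect_mono h0 h1 fun G => by
    by_cases hP : P G
    · simp [hP, h G hP]
    · simp only [hP, if_false]
      split_ifs <;> norm_num

theorem prob_exists_le {ι : Type*} (h0 : 0 ≤ p) (h1 : p ≤ 1) (s : Finset ι)
    (P : ι → SimpleGraph V → Prop) :
    prob p (fun G => ∃ i ∈ s, P i G) ≤ ∑ i ∈ s, prob p (P i) := by
  classical
  unfold prob
  rw [← expect_sum]
  refine expect_mono h0 h1 fun G => ?_
  have hnn : ∀ i ∈ s, (0 : ℝ) ≤ if P i G then 1 else 0 := fun i _ => by split_ifs <;> norm_num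
  split_ifs with h
  · obtain ⟨i, hi, hP⟩ := h
    refine le_trans ?_ (Finset.single_le_sum (f := fun i => if P i G then (1 : ℝ) else 0) hnn hi)
    exact (if_pos hP).ge
  · exact Finset.sum_nonneg (f := fun i => if P i G then (1 : ℝ) else 0) hnn

theorem sum_simpleGraph_eq (F : SimpleGraph V → ℝ) :
    ∑ G, F G = ∑ S ∈ (Finset.univ.filter fun e : Sym2 V => ¬ e.IsDiag).powerset,
      F (fromEdgeSet (S : Set (Sym2 V))) := by
  classical
  symm
  refine Finset.sum_bij' (fun S _ => fromEdgeSet (S : Set (Sym2 V))) (fun G _ => (Set.toFinite G.edgeSet).toFinset)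
    (fun _ _ => Finset.mem_univ _) ?_ ?_ ?_ ?_
  · intro G _
    rw [Finset.mem_powerset]
    intro e he
    rw [Finset.mem_filter]
    exact ⟨Finset.mem_univ _, G.not_isDiag_of_mem_edgeSet ((Set.Finite.mem_toFinset _).1 he)⟩
  · intro S hS
    rw [Finset.mem_powerset] at hS
    ext e
    rw [Set.Finite.mem_toFinset, edgeSet_fromEdgeSet]
    simp only [Set.mem_sdiff, Finset.mem_coe]
    exact ⟨fun h => h.1, fun h => ⟨h, (Finset.mem_filter.1 (hS h)).2⟩⟩
  · intro G _
    simp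
  · intros; rfl

/-- The probability that all pairs in `E₁` are edges and no pair in `E₂` is an edge. -/
theorem prob_cylinder {E₁ E₂ : Finset (Sym2 V)} (hE : Disjoint E₁ E₂)
    (h₁ : ∀ e ∈ E₁, ¬ e.IsDiag) (h₂ : ∀ e ∈ E₂, ¬ e.IsDiag) :
    prob p (fun G => (∀ e ∈ E₁, e ∈ G.edgeSet) ∧ ∀ e ∈ E₂, e ∉ G.edgeSet) =
      p ^ E₁.card * (1 - p) ^ E₂.card := by
  classical
  set U : Finset (Sym2 V) := Finset.univ.filter fun e : Sym2 V => ¬ e.IsDiag with hU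
  have hUc : U.card = (Fintype.card V).choose 2 := by
    rw [← Sym2.card_subtype_not_diag, Fintype.card_subtype]
  set a : Sym2 V → ℝ := fun e => if e ∈ E₂ then 0 else p with ha
  set b : Sym2 V → ℝ := fun e => if e ∈ E₁ then 0 else 1 - p with hb
  have hE₁U : E₁ ⊆ U := fun e he => by simp [hU, h₁ e he]
  have hE₂U : E₂ ⊆ U := fun e he => by simp [hU, h₂ e he]
  obtain ⟨P, hP⟩ : ∃ P : SimpleGraph V → Prop, P = fun G =>
    (∀ e ∈ E₁, e ∈ G.edgeSet) ∧ ∀ e ∈ E₂, e ∉ G.edgeSet := ⟨_, rfl⟩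
  rw [← hP]
  unfold prob expect
  rw [sum_simpleGraph_eq]
  have hterm : ∀ S ∈ U.powerset, weight p (fromEdgeSet (S : Set (Sym2 V))) *
      (if P (fromEdgeSet (S : Set (Sym2 V))) then (1 : ℝ) else 0) =
      (∏ e ∈ S, a e) * ∏ e ∈ U \ S, b e := by
    intro S hS
    rw [Finset.mem_powerset] at hS
    have hes : (fromEdgeSet (S : Set (Sym2 V))).edgeSet = S := by
      ext e
      rw [edgeSet_fromEdgeSet]
      simp only [Set.mem_sdiff, Finset.mem_coe]
      exact ⟨fun h => h.1, fun h => ⟨h, (Finset.mem_filter.1 (hS h)).2⟩⟩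
    have hPS : P (fromEdgeSet (S : Set (Sym2 V))) ↔ (∀ e ∈ E₁, e ∈ S) ∧ ∀ e ∈ E₂, e ∉ S := by
      rw [hP]
      beta_reduce
      rw [hes]
      rfl
    rw [weight, hes, Set.ncard_coe_finset]
    split_ifs with h <;> rw [hPS] at h
    · have h3 : ∏ e ∈ S, a e = p ^ S.card := by
        rw [Finset.prod_congr rfl (g := fun _ => p), Finset.prod_const]
        intro e he
        exact if_neg fun h' => h.2 e h' he
      have h4 : ∏ e ∈ U \ S, b e = (1 - p) ^ ((Fintype.card V).choose 2 - S.card) := by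
        rw [Finset.prod_congr rfl (g := fun _ => 1 - p), Finset.prod_const,
          Finset.card_sdiff_of_subset hS, hUc]
        intro e he
        exact if_neg fun h' => (Finset.mem_sdiff.1 he).2 (h.1 e h')
      rw [h3, h4, mul_one]
    · rw [mul_zero]
      symm
      rw [not_and_or] at h
      push Not at h
      rcases h with ⟨e, he, heS⟩ | ⟨e, he, heS⟩
      · rw [Finset.prod_eq_zero (i := e) (s := U \ S), mul_zero]
        · exact Finset.mem_sdiff.2 ⟨hE₁U he, heS⟩
        · simp [hb, he]
      · rw [Finset.prod_eq_zero (i := e) (s := S), zero_mul]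
        · exact heS
        · simp [ha, he]
  refine (Finset.sum_congr rfl hterm).trans ?_
  rw [← Finset.prod_add]
  have hab : ∀ e ∈ U, a e + b e =
      (if e ∈ E₁ then p else 1) * (if e ∈ E₂ then 1 - p else 1) := by
    intro e _
    by_cases h1 : e ∈ E₁
    · have h2 : e ∉ E₂ := Finset.disjoint_left.1 hE h1
      simp [ha, hb, h1, h2]
    · by_cases h2 : e ∈ E₂ <;> simp [ha, hb, h1, h2]
  rw [Finset.prod_congr rfl hab, Finset.prod_mul_distrib, Finset.prod_ite, Finset.prod_ite,
    Finset.filter_mem_eq_inter, Finset.filter_mem_eq_inter, Finset.inter_eq_right.2 hE₁U,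
    Finset.inter_eq_right.2 hE₂U]
  simp

theorem expect_const (a : ℝ) : expect p (fun _ : SimpleGraph V => a) = a := by
  have h := prob_cylinder (V := V) (p := p) (E₁ := ∅) (E₂ := ∅) (by simp) (by simp) (by simp)
  have h2 := expect_const_mul (V := V) (p := p) a (fun _ => 1)
  simp only [prob, Finset.notMem_empty, false_imp_iff, implies_true, and_self, if_true,
    Finset.card_empty, pow_zero, mul_one] at h
  rw [h] at h2
  simpa using h2

end Probability

/-! ### First moment bounds for connected sets and pockets -/

section FirstMoment

variable {V : Type*} {G : SimpleGraph V} {v w : V} {k : ℕ} {p : ℝ}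

/-- A connected set containing `v` is spanned by a tree, encoded by the map sending each vertex
other than `v` to a neighbour closer to `v`. -/
theorem exists_parent_map [DecidableEq V] {X : Finset V} (hv : v ∈ X)
    (h : ∀ x ∈ X, x ∈ componentIn G X v) :
    ∃ par : {x // x ∈ X.erase v} → {x // x ∈ X}, (∀ x : {x // x ∈ X.erase v}, G.Adj (x : V) (par x : V)) ∧
      Function.Injective fun x : {x // x ∈ X.erase v} => s((x : V), (par x : V)) := by
  classical
  set K := G.induce (X : Set V) with hK
  set d : {x // x ∈ (X : Set V)} → ℕ := fun x => K.dist x ⟨v, hv⟩ with hd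
  have step : ∀ x : {x // x ∈ X.erase v}, ∃ y : {x // x ∈ (X : Set V)}, G.Adj (x : V) (y : V) ∧
      d y < d ⟨x, Finset.mem_of_mem_erase x.2⟩ := by
    rintro ⟨x, hx⟩
    obtain ⟨hxv, hxX⟩ := Finset.mem_erase.1 hx
    obtain ⟨_, _, hr⟩ := h x hxX
    obtain ⟨q, hq⟩ := hr.symm.exists_walk_length_eq_dist
    cases q with
    | nil => exact absurd rfl hxv
    | cons hadj q =>
      refine ⟨_, hadj, ?_⟩
      have h1 := SimpleGraph.dist_le q
      simp only [hd]
      rw [Walk.length_cons] at hq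
      refine h1.trans_lt ?_
      rw [← hq]
      exact Nat.lt_succ_self _
  choose par hadj hlt using step
  refine ⟨par, hadj, fun x y hxy => ?_⟩
  rcases Sym2.eq_iff.1 hxy with ⟨h1, -⟩ | ⟨h1, h2⟩
  · exact Subtype.ext h1
  · have h3 := hlt x
    have h4 := hlt y
    have h5 : par y = ⟨x, Finset.mem_of_mem_erase x.2⟩ := Subtype.ext h1.symm
    have h6 : par x = ⟨y, Finset.mem_of_mem_erase y.2⟩ := Subtype.ext h2
    rw [h5] at h4
    rw [h6] at h3
    omega

/-- Union bound over the spanning trees of `X`, together with prescribed edges `E₁` and non-edges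
`E₂` not contained in `X`. -/
theorem prob_connected_le [Fintype V] [DecidableEq V] (h0 : 0 ≤ p) (h1 : p ≤ 1) {X : Finset V}
    (hv : v ∈ X) {E₁ E₂ : Finset (Sym2 V)} (hE : Disjoint E₁ E₂)
    (hd₁ : ∀ e ∈ E₁, ¬ e.IsDiag) (hd₂ : ∀ e ∈ E₂, ¬ e.IsDiag)
    (hX₁ : ∀ e ∈ E₁, e ∉ X.sym2) (hX₂ : ∀ e ∈ E₂, e ∉ X.sym2) :
    prob p (fun G : SimpleGraph V => (∀ x ∈ X, x ∈ componentIn G X v) ∧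
      (∀ e ∈ E₁, e ∈ G.edgeSet) ∧ ∀ e ∈ E₂, e ∉ G.edgeSet) ≤
      (X.card : ℝ) ^ (X.card - 1) * (p ^ (X.card - 1 + E₁.card) * (1 - p) ^ E₂.card) := by
  classical
  have h1p : 0 ≤ 1 - p := by linarith
  set e : ({x // x ∈ X.erase v} → {x // x ∈ X}) → {x // x ∈ X.erase v} → Sym2 V :=
    fun par (x : {x // x ∈ X.erase v}) => s((x : V), (par x : V)) with he
  set T : ({x // x ∈ X.erase v} → {x // x ∈ X}) → Finset (Sym2 V) :=
    fun par => Finset.univ.image (e par) with hT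
  have hTX : ∀ par, ∀ f ∈ T par, f ∈ X.sym2 := by
    intro par f hf
    obtain ⟨x, -, rfl⟩ := Finset.mem_image.1 hf
    exact Finset.mk_mem_sym2_iff.2 ⟨Finset.mem_of_mem_erase x.2, (par x).2⟩
  refine (prob_mono h0 h1 (P' := fun G => ∃ par ∈ Finset.univ,
    ((∀ x : {x // x ∈ X.erase v}, (x : V) ≠ par x) ∧ Function.Injective (e par)) ∧
      (∀ f ∈ T par ∪ E₁, f ∈ G.edgeSet) ∧ ∀ f ∈ E₂, f ∉ G.edgeSet) ?_).trans ?_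
  · rintro G ⟨hG, hG₁, hG₂⟩
    obtain ⟨par, hadj, hinj⟩ := exists_parent_map hv hG
    refine ⟨par, Finset.mem_univ _, ⟨fun x => (hadj x).ne, hinj⟩, fun f hf => ?_, hG₂⟩
    rcases Finset.mem_union.1 hf with hf | hf
    · obtain ⟨x, -, rfl⟩ := Finset.mem_image.1 hf
      exact hadj x
    · exact hG₁ f hf
  refine (prob_exists_le h0 h1 _ _).trans ?_
  have hbound : ∀ par ∈ (Finset.univ : Finset ({x // x ∈ X.erase v} → {x // x ∈ X})),
      prob p (fun G : SimpleGraph V => ((∀ x : {x // x ∈ X.erase v}, (x : V) ≠ par x) ∧ Function.Injective (e par)) ∧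
        (∀ f ∈ T par ∪ E₁, f ∈ G.edgeSet) ∧ ∀ f ∈ E₂, f ∉ G.edgeSet) ≤
      p ^ (X.card - 1 + E₁.card) * (1 - p) ^ E₂.card := by
    intro par _
    by_cases hpar : (∀ x : {x // x ∈ X.erase v}, (x : V) ≠ par x) ∧ Function.Injective (e par)
    · have hTc : (T par).card = X.card - 1 := by
        rw [hT, Finset.card_image_of_injective _ hpar.2, Finset.card_univ, Fintype.card_coe,
          Finset.card_erase_of_mem hv]
      have hdis : Disjoint (T par) E₁ :=
        Finset.disjoint_left.2 fun f hf hf' => hX₁ f hf' (hTX par f hf)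
      rw [← hTc, ← Finset.card_union_of_disjoint hdis, ← prob_cylinder]
      · exact prob_mono h0 h1 fun G hG => hG.2
      · refine Finset.disjoint_union_left.2 ⟨?_, hE⟩
        exact Finset.disjoint_left.2 fun f hf hf' => hX₂ f hf' (hTX par f hf)
      · intro f hf
        rcases Finset.mem_union.1 hf with hf | hf
        · obtain ⟨x, -, rfl⟩ := Finset.mem_image.1 hf
          exact hpar.1 x
        · exact hd₁ f hf
      · exact hd₂
    · simp only [hpar, false_and]
      have : prob p (fun _ : SimpleGraph V => False) = 0 := by simp [prob, expect]
      rw [this]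
      positivity
  refine (Finset.sum_le_sum hbound).trans (le_of_eq ?_)
  rw [Finset.sum_const, Finset.card_univ, Fintype.card_fun, Fintype.card_coe, Fintype.card_coe,
    Finset.card_erase_of_mem hv, nsmul_eq_mul]
  push_cast
  rfl

/-- The factor `X.card * p` is a union bound over the possible neighbours of `w` in `X`. -/
theorem prob_isPocket_le [Fintype V] [DecidableEq V] (h0 : 0 ≤ p) (h1 : p ≤ 1) {X Q : Finset V}
    (hv : v ∈ X) (hQ : Q ⊆ X) :
    prob p (fun G : SimpleGraph V => IsPocket G v w X Q) ≤
      (X.card : ℝ) ^ (X.card - 1) * (p ^ (X.card - 1) *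
        (1 - p) ^ (Q.card * (Fintype.card V - (X.card + 1)))) *
        if w ∈ X then 1 else X.card * p := by
  classical
  have h1p : 0 ≤ 1 - p := by linarith
  set Y : Finset V := (insert w X)ᶜ with hY
  set E₂ : Finset (Sym2 V) := (Q ×ˢ Y).image fun a => s(a.1, a.2) with hE₂
  have hmemY : ∀ y ∈ Y, y ≠ w ∧ y ∉ X := fun y hy => by
    simpa [hY, not_or] using hy
  have hmem : ∀ f ∈ E₂, ∃ q ∈ Q, ∃ y ∈ Y, f = s(q, y) := by
    intro f hf
    obtain ⟨⟨q, y⟩, hqy, rfl⟩ := Finset.mem_image.1 hf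
    exact ⟨q, (Finset.mem_product.1 hqy).1, y, (Finset.mem_product.1 hqy).2, rfl⟩
  have hcard : E₂.card = Q.card * Y.card := by
    rw [hE₂, Finset.card_image_of_injOn, Finset.card_product]
    rintro ⟨a, b⟩ hab ⟨a', b'⟩ hab' heq
    simp only [Finset.coe_product, Set.mem_prod, Finset.mem_coe] at hab hab'
    rcases Sym2.eq_iff.1 heq with ⟨h, h'⟩ | ⟨h, h'⟩
    · exact Prod.ext h h'
    · simp only at h
      exact absurd (hQ hab.1) (h ▸ (hmemY _ hab'.2).2)
  have hcard' : Q.card * (Fintype.card V - (X.card + 1)) ≤ E₂.card := by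
    rw [hcard, hY, Finset.card_compl]
    exact Nat.mul_le_mul_left _ (Nat.sub_le_sub_left (Finset.card_insert_le _ _) _)
  have hpow : (1 - p) ^ E₂.card ≤ (1 - p) ^ (Q.card * (Fintype.card V - (X.card + 1))) :=
    pow_le_pow_of_le_one h1p (by linarith) hcard'
  have hd₂ : ∀ e ∈ E₂, ¬ e.IsDiag := by
    intro f hf
    obtain ⟨q, hq, y, hy, rfl⟩ := hmem f hf
    exact fun h => (hmemY y hy).2 (Sym2.mk_isDiag_iff.1 h ▸ hQ hq)
  have hX₂ : ∀ e ∈ E₂, e ∉ X.sym2 := by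
    intro f hf
    obtain ⟨q, hq, y, hy, rfl⟩ := hmem f hf
    exact fun h => (hmemY y hy).2 (Finset.mk_mem_sym2_iff.1 h).2
  have hclosed : ∀ G : SimpleGraph V, IsPocket G v w X Q → ∀ e ∈ E₂, e ∉ G.edgeSet := by
    intro G hG f hf
    obtain ⟨q, hq, y, hy, rfl⟩ := hmem f hf
    intro hadj
    exact (hG.closed q hq y hadj).elim (hmemY y hy).2 (hmemY y hy).1
  split_ifs with hw
  · have h := prob_connected_le h0 h1 hv (Finset.disjoint_empty_left E₂) (by simp) hd₂
      (by simp) hX₂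
    rw [mul_one]
    refine (prob_mono h0 h1 fun G hG => ⟨hG.connected, by simp, hclosed G hG⟩).trans (h.trans ?_)
    rw [Finset.card_empty, add_zero]
    gcongr
  · have hstep : ∀ x ∈ X, prob p (fun G : SimpleGraph V => (∀ x ∈ X, x ∈ componentIn G X v) ∧
        (∀ e ∈ ({s(x, w)} : Finset (Sym2 V)), e ∈ G.edgeSet) ∧ ∀ e ∈ E₂, e ∉ G.edgeSet) ≤
        (X.card : ℝ) ^ (X.card - 1) * (p ^ (X.card - 1 + 1) *
          (1 - p) ^ (Q.card * (Fintype.card V - (X.card + 1)))) := by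
      intro x hx
      refine (prob_connected_le h0 h1 hv ?_ ?_ hd₂ ?_ hX₂).trans ?_
      · rw [Finset.disjoint_singleton_left]
        intro hf
        obtain ⟨q, hq, y, hy, h⟩ := hmem _ hf
        rcases Sym2.eq_iff.1 h with ⟨-, h⟩ | ⟨h, -⟩
        · exact (hmemY y hy).1 h.symm
        · exact (hmemY y hy).2 (h ▸ hx)
      · intro f hf
        rw [Finset.mem_singleton.1 hf, Sym2.mk_isDiag_iff]
        rintro rfl
        exact hw hx
      · intro f hf
        rw [Finset.mem_singleton.1 hf]
        exact fun h => hw (Finset.mk_mem_sym2_iff.1 h).2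
      · rw [Finset.card_singleton]
        gcongr
    have hex := prob_exists_le (V := V) h0 h1 X (fun x G => (∀ x ∈ X, x ∈ componentIn G X v) ∧
        (∀ e ∈ ({s(x, w)} : Finset (Sym2 V)), e ∈ G.edgeSet) ∧ ∀ e ∈ E₂, e ∉ G.edgeSet)
    have hsum := hex.trans (Finset.sum_le_sum hstep)
    rw [Finset.sum_const, nsmul_eq_mul, pow_succ] at hsum
    refine (prob_mono h0 h1 fun G hG => ?_).trans (hsum.trans (le_of_eq (by ring)))
    obtain ⟨x, hx, hxw⟩ := hG.touches.resolve_left hw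
    exact ⟨x, hx, hG.connected, by simpa using hxw, hclosed G hG⟩

theorem sum_finset_mem_eq [Fintype V] [DecidableEq V] (v : V) (f : ℕ → ℝ) :
    ∑ X : Finset V, (if v ∈ X then f X.card else 0) =
      ∑ s ∈ Finset.range (Fintype.card V), ((Fintype.card V - 1).choose s : ℝ) * f (s + 1) := by
  have hpos : 0 < Fintype.card V := Fintype.card_pos_iff.2 ⟨v⟩
  have huniv : (Finset.univ : Finset (Finset V)) = (insert v (Finset.univ.erase v)).powerset := by
    rw [Finset.insert_erase (Finset.mem_univ v), Finset.powerset_univ]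
  rw [huniv, Finset.sum_powerset_insert (Finset.notMem_erase v _)]
  have h1 : ∀ X ∈ (Finset.univ.erase v).powerset, (if v ∈ X then f X.card else 0) = 0 := by
    intro X hX
    refine if_neg fun h => ?_
    exact Finset.notMem_erase v _ (Finset.mem_powerset.1 hX h)
  have h2 : ∀ X ∈ (Finset.univ.erase v).powerset,
      (if v ∈ insert v X then f (insert v X).card else 0) = f (X.card + 1) := by
    intro X hX
    rw [if_pos (Finset.mem_insert_self _ _), Finset.card_insert_of_notMem]
    exact fun h => Finset.notMem_erase v _ (Finset.mem_powerset.1 hX h)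
  rw [Finset.sum_eq_zero h1, zero_add, Finset.sum_congr rfl h2,
    Finset.sum_powerset_apply_card fun m => f (m + 1), Finset.card_erase_of_mem (Finset.mem_univ v),
    Finset.card_univ, Nat.sub_add_cancel hpos]
  simp

/-- The contribution to the expected number of pockets of a given pair of sets of sizes `t`
and `q`, summed over the vertices touched. The restriction to `t` of size at most about `n / 100`
keeps `(1 - p) ^ (q * (n - (t + 1)))` below `exp (-(99 / 100) * n * p * q)`. -/
noncomputable def pocketTerm (n k : ℕ) (p : ℝ) (t q : ℕ) : ℝ :=
  if 1 ≤ q ∧ t ≤ 4 * q ∧ 100 * (t + 1) ≤ n then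
    (1 + if k ≤ t then (k : ℝ) else 0) *
      ((t : ℝ) ^ (t - 1) * (p ^ (t - 1) * (1 - p) ^ (q * (n - (t + 1)))) * (t * (1 + n * p)))
  else 0

theorem pocketTerm_nonneg (h0 : 0 ≤ p) (h1 : p ≤ 1) (n t q : ℕ) : 0 ≤ pocketTerm n k p t q := by
  have h1p : 0 ≤ 1 - p := by linarith
  unfold pocketTerm
  split
  · positivity
  · exact le_rfl

theorem expect_pocketCount_le [Fintype V] [DecidableEq V] (h0 : 0 ≤ p) (h1 : p ≤ 1) (v : V) :
    expect p (fun G : SimpleGraph V => pocketCount G k v) ≤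
      ∑ s ∈ Finset.range (Fintype.card V), ((Fintype.card V - 1).choose s : ℝ) *
        ∑ q ∈ Finset.range (s + 2), ((s + 1).choose q : ℝ) *
          pocketTerm (Fintype.card V) k p (s + 1) q := by
  classical
  have h1p : 0 ≤ 1 - p := by linarith
  set n := Fintype.card V with hn
  have hw : ∀ X Q : Finset V, ∑ w : V, expect p (fun G : SimpleGraph V =>
      if 100 * (X.card + 1) ≤ n ∧ IsPocket G v w X Q then
        (1 + if k ≤ X.card then (k : ℝ) else 0) else 0) ≤
      if v ∈ X then (if Q ⊆ X then pocketTerm n k p X.card Q.card else 0) else 0 := by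
    intro X Q
    set a : ℝ := 1 + if k ≤ X.card then (k : ℝ) else 0 with ha
    have ha0 : 0 ≤ a := by positivity
    by_cases hc : v ∈ X ∧ Q ⊆ X ∧ Q.Nonempty ∧ X.card ≤ 4 * Q.card ∧ 100 * (X.card + 1) ≤ n
    · obtain ⟨hv, hQ, hQn, hXQ, hXn⟩ := hc
      rw [if_pos hv, if_pos hQ, pocketTerm, if_pos ⟨hQn.card_pos, hXQ, hXn⟩]
      have he : ∀ w, expect p (fun G : SimpleGraph V =>
          if 100 * (X.card + 1) ≤ n ∧ IsPocket G v w X Q then a else 0) =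
          a * prob p fun G : SimpleGraph V => IsPocket G v w X Q := by
        intro w
        rw [prob, ← expect_const_mul]
        congr 1
        ext G
        simp [hXn]
      simp only [he]
      rw [← Finset.mul_sum]
      refine mul_le_mul_of_nonneg_left ?_ ha0
      refine (Finset.sum_le_sum fun w _ => prob_isPocket_le (w := w) h0 h1 hv hQ).trans ?_
      rw [← Finset.mul_sum]
      refine mul_le_mul_of_nonneg_left ?_ (by positivity)
      have hsplit : ∀ w, (if w ∈ X then (1 : ℝ) else X.card * p) ≤
          (if w ∈ X then (1 : ℝ) else 0) + X.card * p := by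
        intro w
        have : 0 ≤ (X.card : ℝ) * p := by positivity
        split_ifs <;> linarith
      refine (Finset.sum_le_sum fun w _ => hsplit w).trans (le_of_eq ?_)
      rw [Finset.sum_add_distrib, Finset.sum_const, Finset.card_univ, ← hn, Finset.sum_boole,
        nsmul_eq_mul]
      simp only [Finset.filter_mem_eq_inter, Finset.univ_inter]
      ring
    · have hz : ∀ w, expect p (fun G : SimpleGraph V =>
          if 100 * (X.card + 1) ≤ n ∧ IsPocket G v w X Q then a else 0) = 0 := by
        intro w
        have : (fun G : SimpleGraph V =>
            if 100 * (X.card + 1) ≤ n ∧ IsPocket G v w X Q then a else 0) = fun _ => 0 := by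
          ext G
          refine if_neg ?_
          rintro ⟨hX, hG⟩
          exact hc ⟨hG.mem, hG.subset, hG.nonempty, hG.card_le, hX⟩
        rw [this, expect_const]
      rw [Finset.sum_eq_zero fun w _ => hz w]
      have := pocketTerm_nonneg (k := k) h0 h1 n X.card Q.card
      split_ifs <;> first | exact this | exact le_rfl
  have hsum : expect p (fun G : SimpleGraph V => pocketCount G k v) ≤ ∑ X : Finset V,
      ∑ Q : Finset V, if v ∈ X then (if Q ⊆ X then pocketTerm n k p X.card Q.card else 0) else 0 := by
    simp only [pocketCount, expect_sum]
    rw [Finset.sum_comm]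
    refine Finset.sum_le_sum fun X _ => ?_
    rw [Finset.sum_comm]
    refine Finset.sum_le_sum fun Q _ => ?_
    exact hw X Q
  refine hsum.trans (le_of_eq ?_)
  rw [hn, ← sum_finset_mem_eq v fun t => ∑ q ∈ Finset.range (t + 1), (t.choose q : ℝ) *
    pocketTerm n k p t q]
  refine Finset.sum_congr rfl fun X _ => ?_
  split_ifs with hv
  · have h := Finset.sum_powerset_apply_card (fun q => pocketTerm n k p X.card q) (x := X)
    simp only [nsmul_eq_mul] at h
    rw [← h, ← Finset.sum_filter]
    refine Finset.sum_congr ?_ fun _ _ => rfl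
    ext Q
    simp
  · simp

/-! ### The ball is rarely huge -/

theorem support_subset_componentIn {X : Set V} {a b : V} (q : G.Walk a b)
    (hX : ∀ x ∈ q.support, x ∈ X) (ha : a ∈ componentIn G X v) :
    ∀ x ∈ q.support, x ∈ componentIn G X v := by
  induction q with
  | nil => simpa using ha
  | cons h q ih =>
    intro x hx
    rw [Walk.support_cons, List.mem_cons] at hx
    rcases hx with rfl | hx
    · exact ha
    · refine ih (fun y hy => hX y (List.mem_cons_of_mem _ hy)) (componentIn_adj ha ?_ h) x hx
      exact hX _ (List.mem_cons_of_mem _ q.start_mem_support)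

/-- Two vertices of the ball lie in a common connected set with at most `2 * k + 2` vertices. -/
theorem exists_connected_of_mem_ball [DecidableEq V] {x y : V} (hx : x ∈ ball G v k)
    (hy : y ∈ ball G v k) :
    ∃ X : Finset V, v ∈ X ∧ X.card ≤ 2 * k + 2 ∧ (∀ z ∈ X, z ∈ componentIn G X v) ∧
      x ∈ X ∧ y ∈ X := by
  have hwalk : ∀ x ∈ ball G v k, ∃ q : G.Walk v x, q.length ≤ k := by
    intro x hx
    obtain ⟨q, hq⟩ := SimpleGraph.exists_walk_of_edist_ne_top
      (ne_top_of_le_ne_top (ENat.natCast_ne_top k) (show G.edist v x ≤ k from hx))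
    refine ⟨q, ?_⟩
    have : G.edist v x ≤ k := hx
    rw [← hq] at this
    exact_mod_cast this
  obtain ⟨q, hq⟩ := hwalk x hx
  obtain ⟨r, hr⟩ := hwalk y hy
  have hv : v ∈ q.support.toFinset ∪ r.support.toFinset := by simp
  refine ⟨q.support.toFinset ∪ r.support.toFinset, hv, ?_, ?_, by simp, by simp⟩
  · have h1 := q.support.toFinset_card_le
    have h2 := r.support.toFinset_card_le
    have h3 := Finset.card_union_le q.support.toFinset r.support.toFinset
    rw [Walk.length_support] at h1 h2
    omega
  · intro z hz
    rcases Finset.mem_union.1 hz with h | h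
    · exact support_subset_componentIn q (fun u hu => by simp [hu]) (mem_componentIn_self hv) z
        (List.mem_toFinset.1 h)
    · exact support_subset_componentIn r (fun u hu => by simp [hu]) (mem_componentIn_self hv) z
        (List.mem_toFinset.1 h)

/-- The second moment of the size of the ball is bounded independently of the number of
vertices. -/
theorem expect_ball_sq_le [Fintype V] [DecidableEq V] (h0 : 0 ≤ p) (h1 : p ≤ 1) (v : V) :
    expect p (fun G : SimpleGraph V => ((ball G v k).ncard : ℝ) ^ 2) ≤
      ∑ s ∈ Finset.range (2 * k + 2), ((s + 1 : ℕ) : ℝ) ^ (s + 2) * (Fintype.card V * p) ^ s := by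
  classical
  set n := Fintype.card V with hn
  have hpoint : ∀ G : SimpleGraph V, ((ball G v k).ncard : ℝ) ^ 2 ≤ ∑ X : Finset V,
      if v ∈ X ∧ X.card ≤ 2 * k + 2 then
        (X.card : ℝ) ^ 2 * (if ∀ z ∈ X, z ∈ componentIn G X v then 1 else 0) else 0 := by
    intro G
    set B : Finset V := (Set.toFinite (ball G v k)).toFinset with hB
    have hmemB : ∀ x, x ∈ B ↔ x ∈ ball G v k := fun x => Set.Finite.mem_toFinset _
    have hcard : (ball G v k).ncard = B.card := Set.ncard_eq_toFinset_card _ _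
    set 𝒳 : Finset (Finset V) := Finset.univ.filter fun X => (v ∈ X ∧ X.card ≤ 2 * k + 2) ∧
      ∀ z ∈ X, z ∈ componentIn G X v with h𝒳
    have hsub : B ×ˢ B ⊆ 𝒳.biUnion fun X => X ×ˢ X := by
      rintro ⟨x, y⟩ hxy
      obtain ⟨hx, hy⟩ := Finset.mem_product.1 hxy
      obtain ⟨X, h1, h2, h3, h4, h5⟩ := exists_connected_of_mem_ball ((hmemB x).1 hx)
        ((hmemB y).1 hy)
      refine Finset.mem_biUnion.2 ⟨X, ?_, Finset.mem_product.2 ⟨h4, h5⟩⟩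
      rw [h𝒳, Finset.mem_filter]
      exact ⟨Finset.mem_univ _, ⟨h1, h2⟩, h3⟩
    have h2 : B.card ^ 2 ≤ ∑ X ∈ 𝒳, X.card ^ 2 := by
      have h3 := (Finset.card_le_card hsub).trans Finset.card_biUnion_le
      simpa only [Finset.card_product, sq] using h3
    rw [hcard]
    have h3 : ((B.card : ℝ)) ^ 2 ≤ ∑ X ∈ 𝒳, (X.card : ℝ) ^ 2 := by exact_mod_cast h2
    refine h3.trans (le_of_eq ?_)
    rw [h𝒳, Finset.sum_filter]
    refine Finset.sum_congr rfl fun X _ => ?_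
    by_cases ha : v ∈ X ∧ X.card ≤ 2 * k + 2 <;>
      by_cases hb : ∀ z ∈ X, z ∈ componentIn G X v
    · rw [if_pos ⟨ha, hb⟩, if_pos ha, if_pos hb, mul_one]
    · rw [if_neg fun h => hb h.2, if_pos ha, if_neg hb, mul_zero]
    · rw [if_neg fun h => ha h.1, if_neg ha]
    · rw [if_neg fun h => ha h.1, if_neg ha]
  refine (expect_mono h0 h1 hpoint).trans ?_
  rw [expect_sum]
  have hX : ∀ X : Finset V, expect p (fun G : SimpleGraph V =>
      if v ∈ X ∧ X.card ≤ 2 * k + 2 then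
        (X.card : ℝ) ^ 2 * (if ∀ z ∈ X, z ∈ componentIn G X v then 1 else 0) else 0) ≤
      if v ∈ X then (if X.card ≤ 2 * k + 2 then
        (X.card : ℝ) ^ 2 * ((X.card : ℝ) ^ (X.card - 1) * p ^ (X.card - 1)) else 0) else 0 := by
    intro X
    by_cases ha : v ∈ X ∧ X.card ≤ 2 * k + 2
    · simp only [ha, and_self, if_true]
      rw [expect_const_mul]
      have hp := prob_connected_le (V := V) h0 h1 ha.1 (Finset.disjoint_empty_left ∅) (by simp)
        (by simp) (by simp) (by simp)
      simp only [Finset.notMem_empty, false_imp_iff, implies_true, and_true, Finset.card_empty,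
        add_zero, pow_zero, mul_one] at hp
      refine mul_le_mul_of_nonneg_left ?_ (by positivity)
      refine le_trans (le_of_eq ?_) hp
      unfold prob
      congr!
    · simp only [ha, if_false]
      rw [expect_const]
      split_ifs <;> positivity
  refine (Finset.sum_le_sum fun X _ => hX X).trans ?_
  rw [sum_finset_mem_eq v fun t => if t ≤ 2 * k + 2 then
        (t : ℝ) ^ 2 * ((t : ℝ) ^ (t - 1) * p ^ (t - 1)) else 0]
  have hterm : ∀ s ∈ Finset.range n, ((n - 1).choose s : ℝ) * (if s + 1 ≤ 2 * k + 2 then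
        ((s + 1 : ℕ) : ℝ) ^ 2 * (((s + 1 : ℕ) : ℝ) ^ (s + 1 - 1) * p ^ (s + 1 - 1)) else 0) ≤
      if s ∈ Finset.range (2 * k + 2) then
        ((s + 1 : ℕ) : ℝ) ^ (s + 2) * (n * p) ^ s else 0 := by
    intro s _
    by_cases hs : s + 1 ≤ 2 * k + 2
    · rw [if_pos hs, if_pos (Finset.mem_range.2 (by omega)), Nat.add_sub_cancel]
      have hch : ((n - 1).choose s : ℝ) ≤ (n : ℝ) ^ s := by
        have h1 : (n - 1).choose s ≤ n ^ s :=
          (Nat.choose_le_pow _ _).trans (Nat.pow_le_pow_left (Nat.sub_le _ _) _)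
        exact_mod_cast h1
      calc ((n - 1).choose s : ℝ) * (((s + 1 : ℕ) : ℝ) ^ 2 * (((s + 1 : ℕ) : ℝ) ^ s * p ^ s))
          ≤ (n : ℝ) ^ s * (((s + 1 : ℕ) : ℝ) ^ 2 * (((s + 1 : ℕ) : ℝ) ^ s * p ^ s)) := by
            gcongr
        _ = _ := by ring
    · rw [if_neg hs, mul_zero]
      positivity
  refine (Finset.sum_le_sum hterm).trans ?_
  rw [← Finset.sum_filter]
  refine Finset.sum_le_sum_of_subset_of_nonneg (fun s hs => (Finset.mem_filter.1 hs).2) ?_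
  intro s _ _
  positivity

/-- The probability of a huge ball is of order `n⁻²`. -/
theorem prob_hasHugeBall_le [Fintype V] [DecidableEq V] (h0 : 0 ≤ p) (h1 : p ≤ 1) (v : V) :
    prob p (fun G : SimpleGraph V => HasHugeBall G k v) ≤
      200 ^ 2 / (Fintype.card V : ℝ) ^ 2 *
        ∑ s ∈ Finset.range (2 * k + 2),
          ((s + 1 : ℕ) : ℝ) ^ (s + 2) * (Fintype.card V * p) ^ s := by
  classical
  refine le_trans ?_ (mul_le_mul_of_nonneg_left (expect_ball_sq_le (k := k) h0 h1 v)
    (by positivity))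
  rw [← expect_const_mul]
  refine expect_mono h0 h1 fun G => ?_
  split_ifs with h
  · have hn : 0 < (Fintype.card V : ℝ) := by exact_mod_cast Fintype.card_pos_iff.2 ⟨v⟩
    have hb : 1 ≤ (ball G v k).ncard := by
      rw [Nat.one_le_iff_ne_zero, ← Nat.pos_iff_ne_zero, Set.ncard_pos]
      exact ⟨v, by simp [ball]⟩
    have h2 : Fintype.card V ≤ 200 * (ball G v k).ncard := by
      unfold HasHugeBall at h
      omega
    have h3 : (Fintype.card V : ℝ) ≤ 200 * (ball G v k).ncard := by exact_mod_cast h2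
    rw [div_mul_eq_mul_div, le_div_iff₀ (by positivity), one_mul, ← mul_pow]
    gcongr
  · positivity

end FirstMoment

/-! ### The expected number of pockets is less than one -/

section Estimates

open Real

/-- With `t = s + 1`, this is the bound `t ^ t / t! ≤ exp (t - 1)`. It saves a factor `e` over
the bound from the exponential series, without which the bound for the sum over pockets would
exceed one. -/
theorem succ_pow_le_factorial_mul_exp (s : ℕ) :
    ((s + 1 : ℕ) : ℝ) ^ s ≤ (s.factorial : ℝ) * exp s := by
  induction s with
  | zero => simp
  | succ s ih =>
    have hpos : (0 : ℝ) < (s : ℝ) + 1 := by positivity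
    have h1 : (1 + 1 / ((s : ℝ) + 1)) ^ (s + 1) ≤ exp 1 := by
      have h2 : 1 + 1 / ((s : ℝ) + 1) ≤ exp (1 / ((s : ℝ) + 1)) := by
        rw [add_comm]
        exact add_one_le_exp _
      calc (1 + 1 / ((s : ℝ) + 1)) ^ (s + 1) ≤ exp (1 / ((s : ℝ) + 1)) ^ (s + 1) := by gcongr
        _ = exp 1 := by
          rw [← exp_nat_mul]
          congr 1
          push_cast
          field_simp
    have h3 : (((s + 1 : ℕ) + 1 : ℕ) : ℝ) = (1 + 1 / ((s : ℝ) + 1)) * ((s : ℝ) + 1) := by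
      push_cast
      field_simp
    rw [h3, mul_pow, pow_succ ((s : ℝ) + 1) s, Nat.factorial_succ]
    push_cast at ih ⊢
    rw [exp_add]
    calc (1 + 1 / ((s : ℝ) + 1)) ^ (s + 1) * (((s : ℝ) + 1) ^ s * ((s : ℝ) + 1))
        ≤ exp 1 * ((s.factorial * exp s) * ((s : ℝ) + 1)) := by gcongr
      _ = _ := by ring

/-- The term of index `q` in the binomial expansion of `(1 / 3 + 1) ^ t`; the weight `1 / 3` is
the best one for `t = 4 * q`, the case that dominates the sum over pockets. -/
theorem choose_le_four_thirds_pow (t q : ℕ) :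
    (t.choose q : ℝ) ≤ (4 / 3) ^ t * 3 ^ q := by
  rcases lt_or_ge t q with h | h
  · rw [Nat.choose_eq_zero_of_lt h, Nat.cast_zero]
    positivity
  have h1 : ((1 / 3 : ℝ)) ^ q * 1 ^ (t - q) * (t.choose q : ℝ) ≤ (1 / 3 + 1) ^ t := by
    rw [add_pow]
    refine Finset.single_le_sum (f := fun m => ((1 / 3 : ℝ)) ^ m * 1 ^ (t - m) * (t.choose m : ℝ))
      (fun m _ => by positivity) (Finset.mem_range.2 (by omega))
  rw [one_pow, mul_one] at h1
  have h2 : (t.choose q : ℝ) = 3 ^ q * ((1 / 3 : ℝ) ^ q * (t.choose q : ℝ)) := by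
    rw [← mul_assoc, ← mul_pow]
    norm_num
  rw [h2, mul_comm _ ((3 : ℝ) ^ q)]
  norm_num at h1 ⊢
  linarith

theorem one_add_four_mul_le_pow (q : ℕ) (hq : 25 ≤ q) :
    1 + 4 * (q : ℝ) ≤ (5 / 4) ^ (q - 1) := by
  induction q, hq using Nat.le_induction with
  | base => norm_num
  | succ q hq ih =>
    obtain ⟨m, rfl⟩ : ∃ m, q = m + 1 := ⟨q - 1, by omega⟩
    rw [Nat.add_sub_cancel] at ih ⊢
    rw [pow_succ]
    push_cast at ih ⊢
    have : (24 : ℝ) ≤ m := by exact_mod_cast (by omega : 24 ≤ m)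
    nlinarith

theorem sum_pow_succ_le {y : ℝ} (hy : 72 ≤ y) (m : ℕ) :
    ∑ s ∈ Finset.range m, y ^ (s + 1) ≤ 72 / 71 * y ^ m := by
  induction m with
  | zero => norm_num
  | succ m ih =>
    rw [Finset.sum_range_succ]
    have h1 : 72 * y ^ m ≤ y ^ (m + 1) := by
      rw [pow_succ']
      gcongr
    linarith

theorem sum_mul_pow_le {r : ℝ} (h0 : 0 ≤ r) (h1 : r < 1) (N : ℕ) :
    ∑ q ∈ Finset.range N, (q : ℝ) * r ^ q ≤ r / (1 - r) ^ 2 := by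
  have h : ‖r‖ < 1 := by rwa [norm_of_nonneg h0]
  exact sum_le_hasSum _ (fun q _ => by positivity) (hasSum_coe_mul_geometric_of_norm_lt_one h)

variable {c : ℝ} {n k : ℕ}

/-- Here `c ≥ 20` matters: a pocket costs a factor `e⁻ᶜ` for each vertex without further
neighbours, and gains a factor `c` for each of at most four times as many tree edges. -/
theorem pocket_ratio_le (hc : 20 ≤ c) :
    (4 / 3 * c * exp 1) ^ 4 * (3 * exp (-(99 / 100) * c)) ≤ 2135 / 10000 := by
  have h1 : c ^ 4 ≤ 160000 * exp ((c - 20) / 5) := by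
    have h2 : c / 20 ≤ exp (c / 20 - 1) := by
      have := add_one_le_exp (c / 20 - 1)
      linarith
    have h3 : (c / 20) ^ 4 ≤ exp (c / 20 - 1) ^ 4 := by gcongr
    rw [← exp_nat_mul] at h3
    have h4 : ((4 : ℕ) : ℝ) * (c / 20 - 1) = (c - 20) / 5 := by
      push_cast
      ring
    rw [h4, div_pow] at h3
    norm_num at h3
    linarith
  have h5 : exp 1 ^ 4 * exp ((c - 20) / 5) * exp (-(99 / 100) * c) ≤ exp (-(158 / 10)) := by
    rw [← exp_nat_mul, ← exp_add, ← exp_add]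
    refine exp_le_exp.2 ?_
    push_cast
    linarith
  have h6 : (7105560 : ℝ) ≤ exp (158 / 10) := by
    have h7 : exp (158 / 10) = exp 1 ^ 16 * exp (-(1 / 5)) := by
      rw [← exp_nat_mul, ← exp_add]
      norm_num
    have h8 : (4 / 5 : ℝ) ≤ exp (-(1 / 5)) := by
      have := add_one_le_exp (-(1 / 5) : ℝ)
      linarith
    have h9 : (2.718281828 : ℝ) ^ 16 ≤ exp 1 ^ 16 := by
      have := exp_one_gt_d9
      gcongr
      linarith
    rw [h7]
    calc (7105560 : ℝ) ≤ (2.718281828 : ℝ) ^ 16 * (4 / 5) := by norm_num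
      _ ≤ _ := by gcongr
  have h10 : exp (-(158 / 10)) ≤ 1 / 7105560 := by
    rw [exp_neg, ← one_div]
    exact one_div_le_one_div_of_le (by norm_num) h6
  calc (4 / 3 * c * exp 1) ^ 4 * (3 * exp (-(99 / 100) * c))
      = 256 / 27 * c ^ 4 * exp 1 ^ 4 * exp (-(99 / 100) * c) := by ring
    _ ≤ 256 / 27 * (160000 * exp ((c - 20) / 5)) * exp 1 ^ 4 * exp (-(99 / 100) * c) := by gcongr
    _ = 256 / 27 * 160000 * (exp 1 ^ 4 * exp ((c - 20) / 5) * exp (-(99 / 100) * c)) := by ring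
    _ ≤ 256 / 27 * 160000 * (1 / 7105560) := by
      have := h5.trans h10
      gcongr
    _ ≤ _ := by norm_num

theorem pocketTerm_le (hc : 20 ≤ c) (hk : 100 ≤ k) (hcn : c ≤ n) {s q : ℕ} :
    ((n - 1).choose s : ℝ) * (((s + 1).choose q : ℝ) * pocketTerm n k (c / n) (s + 1) q) ≤
      (1 + c) / (c * exp 1) * if 1 ≤ q ∧ s + 1 ≤ 4 * q then
        (5 / 4 : ℝ) ^ (q - 1) * (4 * q) * (3 * exp (-(99 / 100) * c)) ^ q *
          (4 / 3 * c * exp 1) ^ (s + 1) else 0 := by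
  have hc0 : 0 < c := by linarith
  have hn0 : (0 : ℝ) < n := by linarith
  set p := c / n with hp
  have hp0 : 0 ≤ p := by positivity
  have hp1 : p ≤ 1 := (div_le_one hn0).2 hcn
  have hnp : n * p = c := by
    rw [hp]
    field_simp
  have h1p : 0 ≤ 1 - p := by linarith
  by_cases h : 1 ≤ q ∧ s + 1 ≤ 4 * q
  swap
  · rw [if_neg h, pocketTerm, if_neg fun h' => h ⟨h'.1, h'.2.1⟩]
    simp
  rw [if_pos h]
  obtain ⟨hq, hs⟩ := h
  by_cases hsn : 100 * (s + 1 + 1) ≤ n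
  swap
  · rw [pocketTerm, if_neg fun h' => hsn h'.2.2]
    simp only [mul_zero]
    positivity
  rw [pocketTerm, if_pos ⟨hq, hs, hsn⟩, Nat.add_sub_cancel, hnp]
  -- Large pockets are counted `k + 1` times, but they have `100 ≤ k ≤ s + 1 ≤ 4 * q`, so the
  -- weight is absorbed by a slight increase of the ratio of the geometric sum.
  have hweight : (1 + if k ≤ s + 1 then (k : ℝ) else 0) ≤ (5 / 4 : ℝ) ^ (q - 1) := by
    split_ifs with hks
    · refine le_trans ?_ (one_add_four_mul_le_pow q (by omega))
      have : (k : ℝ) ≤ 4 * q := by exact_mod_cast hks.trans hs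
      linarith
    · rw [add_zero]
      exact one_le_pow₀ (by norm_num)
  have hchoose : ((n - 1).choose s : ℝ) * (((s + 1 : ℕ) : ℝ) ^ s * p ^ s) ≤ (c * exp 1) ^ s := by
    have h1 : ((n - 1).choose s : ℝ) ≤ (n : ℝ) ^ s / s.factorial := by
      refine (Nat.choose_le_pow_div s (n - 1)).trans ?_
      have : ((n - 1 : ℕ) : ℝ) ≤ n := by exact_mod_cast Nat.sub_le n 1
      gcongr
    have h2 := succ_pow_le_factorial_mul_exp s
    have h3 : (0 : ℝ) < s.factorial := by exact_mod_cast s.factorial_pos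
    calc ((n - 1).choose s : ℝ) * (((s + 1 : ℕ) : ℝ) ^ s * p ^ s)
        ≤ ((n : ℝ) ^ s / s.factorial) * ((s.factorial * exp s) * p ^ s) := by gcongr
      _ = (n * p) ^ s * exp s := by
        rw [mul_pow]
        field_simp
      _ = (c * exp 1) ^ s := by
        rw [hnp, mul_pow, ← exp_nat_mul, mul_one]
  have hexp : (1 - p) ^ (q * (n - (s + 1 + 1))) ≤ exp (-(99 / 100) * c) ^ q := by
    have h1 : 1 - p ≤ exp (-p) := one_sub_le_exp_neg p
    calc (1 - p) ^ (q * (n - (s + 1 + 1))) ≤ exp (-p) ^ (q * (n - (s + 1 + 1))) := by gcongr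
      _ = exp (-p * (n - (s + 1 + 1) : ℕ)) ^ q := by
        rw [mul_comm q, pow_mul, ← exp_nat_mul]
        congr 2
        ring
      _ ≤ exp (-(99 / 100) * c) ^ q := by
        refine pow_le_pow_left₀ (exp_pos _).le (exp_le_exp.2 ?_) q
        have h2 : (100 : ℝ) * (s + 1 + 1) ≤ n := by exact_mod_cast hsn
        rw [Nat.cast_sub (by omega)]
        push_cast
        have h3 : p * (100 * ((s : ℝ) + 1 + 1)) ≤ p * n := by gcongr
        nlinarith
  have ht : ((s + 1 : ℕ) : ℝ) ≤ 4 * q := by exact_mod_cast hs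
  set x : ℝ := exp (-(99 / 100) * c) with hx
  calc ((n - 1).choose s : ℝ) * (((s + 1).choose q : ℝ) *
        ((1 + if k ≤ s + 1 then (k : ℝ) else 0) *
          (((s + 1 : ℕ) : ℝ) ^ s * (p ^ s * (1 - p) ^ (q * (n - (s + 1 + 1)))) *
            (((s + 1 : ℕ) : ℝ) * (1 + c)))))
      = (((n - 1).choose s : ℝ) * (((s + 1 : ℕ) : ℝ) ^ s * p ^ s)) * ((s + 1).choose q : ℝ) *
        (1 + if k ≤ s + 1 then (k : ℝ) else 0) * (1 - p) ^ (q * (n - (s + 1 + 1))) *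
          ((s + 1 : ℕ) : ℝ) * (1 + c) := by ring
    _ ≤ (c * exp 1) ^ s * ((4 / 3) ^ (s + 1) * 3 ^ q) * (5 / 4 : ℝ) ^ (q - 1) * x ^ q *
          (4 * q) * (1 + c) := by
        have := choose_le_four_thirds_pow (s + 1) q
        gcongr
    _ = _ := by
        have he : exp 1 ≠ 0 := (exp_pos 1).ne'
        rw [mul_pow 3 x q, mul_assoc (4 / 3) c (exp 1), mul_pow (4 / 3) (c * exp 1) (s + 1),
          pow_succ (c * exp 1) s]
        field_simp

/-- The first moment bound for pockets. For each `q` the sum over `s + 1 ≤ 4 * q` is dominated by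
its last term, and what remains is the derivative of a geometric series in `q`. -/
theorem sum_pocketTerm_le (hc : 20 ≤ c) (hk : 100 ≤ k) (hcn : c ≤ n) :
    ∑ s ∈ Finset.range n, ((n - 1).choose s : ℝ) *
        ∑ q ∈ Finset.range (s + 2), ((s + 1).choose q : ℝ) * pocketTerm n k (c / n) (s + 1) q ≤
      7 / 10 := by
  have hc0 : 0 < c := by linarith
  have he := exp_one_gt_d9
  set y : ℝ := 4 / 3 * c * exp 1 with hy
  set z : ℝ := 3 * exp (-(99 / 100) * c) with hz
  have hy72 : 72 ≤ y := by
    have h1 : (20 : ℝ) * 2.7 ≤ c * exp 1 := by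
      gcongr
      linarith
    rw [hy]
    linarith
  have hz0 : 0 < z := by positivity
  set r : ℝ := 5 / 4 * (y ^ 4 * z) with hr
  have hr0 : 0 ≤ r := by positivity
  have hr1 : r ≤ 267 / 1000 := by
    have h : y ^ 4 * z ≤ 2135 / 10000 := pocket_ratio_le hc
    rw [hr]
    linarith
  set g : ℕ → ℕ → ℝ := fun s q => if 1 ≤ q ∧ s + 1 ≤ 4 * q then
    (5 / 4 : ℝ) ^ (q - 1) * (4 * q) * z ^ q * y ^ (s + 1) else 0 with hg
  have hg0 : ∀ s q, 0 ≤ g s q := fun s q => by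
    simp only [hg]
    split
    · positivity
    · exact le_rfl
  have hstep1 : ∑ s ∈ Finset.range n, ((n - 1).choose s : ℝ) *
        ∑ q ∈ Finset.range (s + 2), ((s + 1).choose q : ℝ) * pocketTerm n k (c / n) (s + 1) q ≤
      (1 + c) / (c * exp 1) * ∑ q ∈ Finset.range (n + 1), ∑ s ∈ Finset.range n, g s q := by
    rw [Finset.sum_comm, Finset.mul_sum]
    refine Finset.sum_le_sum fun s hs => ?_
    rw [Finset.mul_sum, Finset.mul_sum]
    refine (Finset.sum_le_sum fun q _ => pocketTerm_le hc hk hcn).trans ?_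
    have hsn := Finset.mem_range.1 hs
    refine Finset.sum_le_sum_of_subset_of_nonneg (Finset.range_subset_range.2 (by omega)) ?_
    intro q _ _
    exact mul_nonneg (by positivity) (hg0 s q)
  clear_value r y z
  have hstep2 : ∀ q, ∑ s ∈ Finset.range n, g s q ≤ 4 * (72 / 71) * (4 / 5) * (q * r ^ q) := by
    intro q
    rcases Nat.eq_zero_or_pos q with rfl | hq
    · simp [hg]
    have h1 : ∑ s ∈ Finset.range n, g s q ≤ ∑ s ∈ Finset.range (4 * q),
        (5 / 4 : ℝ) ^ (q - 1) * (4 * q) * z ^ q * y ^ (s + 1) := by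
      simp only [hg]
      rw [← Finset.sum_filter]
      refine Finset.sum_le_sum_of_subset_of_nonneg (fun s hs => ?_) fun s _ _ => by positivity
      have := (Finset.mem_filter.1 hs).2
      exact Finset.mem_range.2 (by omega)
    refine h1.trans ?_
    rw [← Finset.mul_sum]
    have h2 := sum_pow_succ_le hy72 (4 * q)
    have h3 : (5 / 4 : ℝ) ^ (q - 1) = 4 / 5 * (5 / 4) ^ q := by
      obtain ⟨m, rfl⟩ : ∃ m, q = m + 1 := ⟨q - 1, by omega⟩
      rw [Nat.add_sub_cancel, pow_succ]
      ring
    calc (5 / 4 : ℝ) ^ (q - 1) * (4 * q) * z ^ q * ∑ s ∈ Finset.range (4 * q), y ^ (s + 1)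
        ≤ (5 / 4 : ℝ) ^ (q - 1) * (4 * q) * z ^ q * (72 / 71 * y ^ (4 * q)) := by gcongr
      _ = 4 * (72 / 71) * (4 / 5) * (q * r ^ q) := by
        rw [h3, hr, mul_pow, mul_pow, ← pow_mul]
        ring
  have hstep3 : ∑ q ∈ Finset.range (n + 1), ∑ s ∈ Finset.range n, g s q ≤
      4 * (72 / 71) * (4 / 5) * (r / (1 - r) ^ 2) := by
    refine (Finset.sum_le_sum fun q _ => hstep2 q).trans ?_
    rw [← Finset.mul_sum]
    have := sum_mul_pow_le hr0 (by linarith) (n + 1)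
    gcongr
  have hr2 : r / (1 - r) ^ 2 ≤ 1 / 2 := by
    rw [div_le_iff₀ (by nlinarith)]
    nlinarith
  have hcc : (1 + c) / (c * exp 1) ≤ 387 / 1000 := by
    rw [div_le_iff₀ (by positivity)]
    nlinarith
  have hS0 : 0 ≤ ∑ q ∈ Finset.range (n + 1), ∑ s ∈ Finset.range n, g s q :=
    Finset.sum_nonneg fun q _ => Finset.sum_nonneg fun s _ => hg0 s q
  calc _ ≤ _ := hstep1
    _ ≤ 387 / 1000 * (4 * (72 / 71) * (4 / 5) * (r / (1 - r) ^ 2)) := by gcongr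
    _ ≤ 387 / 1000 * (4 * (72 / 71) * (4 / 5) * (1 / 2)) := by gcongr
    _ ≤ 7 / 10 := by norm_num

end Estimates

/-! ### Isolated vertices -/

section Isolated

variable {V : Type*} {p : ℝ} {w w' : V}

/-- The vertex `w` has no neighbours. -/
def IsIsolated (G : SimpleGraph V) (w : V) : Prop := ∀ y, ¬ G.Adj w y

theorem deleteIncidenceSet_of_isIsolated {G : SimpleGraph V} (h : IsIsolated G w) :
    G.deleteIncidenceSet w = G := by
  ext x y
  rw [deleteIncidenceSet_adj]
  exact ⟨fun h => h.1, fun hxy => ⟨hxy, fun hx => h y (hx ▸ hxy), fun hy => h x (hy ▸ hxy.symm)⟩⟩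

theorem isIsolated_deleteIncidenceSet (G : SimpleGraph V) (w : V) :
    IsIsolated (G.deleteIncidenceSet w) w := by
  intro y
  simp [deleteIncidenceSet_adj]

variable [Fintype V] [DecidableEq V]

/-- The pairs of vertices containing `w`. -/
def pairsAt (w : V) : Finset (Sym2 V) := (Finset.univ.erase w).image fun y => s(w, y)

theorem card_pairsAt (w : V) : (pairsAt w).card = Fintype.card V - 1 := by
  rw [pairsAt, Finset.card_image_of_injective, Finset.card_erase_of_mem (Finset.mem_univ _),
    Finset.card_univ]
  intro a b h
  exact Sym2.congr_right.1 h

theorem mem_pairsAt {e : Sym2 V} : e ∈ pairsAt w ↔ w ∈ e ∧ ¬ e.IsDiag := by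
  induction e with | _ a b
  simp only [pairsAt, Finset.mem_image, Finset.mem_erase, Finset.mem_univ, and_true, Sym2.mem_iff,
    Sym2.mk_isDiag_iff]
  constructor
  · rintro ⟨y, hy, h⟩
    rcases Sym2.eq_iff.1 h with ⟨rfl, rfl⟩ | ⟨rfl, rfl⟩
    · exact ⟨.inl rfl, hy.symm⟩
    · exact ⟨.inr rfl, hy⟩
  · rintro ⟨rfl | rfl, h⟩
    · exact ⟨b, Ne.symm h, rfl⟩
    · exact ⟨a, h, Sym2.eq_swap⟩

theorem isIsolated_iff {G : SimpleGraph V} : IsIsolated G w ↔ ∀ e ∈ pairsAt w, e ∉ G.edgeSet := by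
  constructor
  · intro h e he
    obtain ⟨y, -, rfl⟩ := Finset.mem_image.1 he
    exact h y
  · intro h y hy
    exact h s(w, y) (mem_pairsAt.2 ⟨Sym2.mem_mk_left _ _, hy.ne⟩) hy

open Classical in
theorem expect_eq_sum_prob (F : SimpleGraph V → ℝ) (P : SimpleGraph V → Prop) :
    expect p (fun G => F (G.deleteIncidenceSet w) * if P G then 1 else 0) =
      ∑ H, F H * prob p fun G => G.deleteIncidenceSet w = H ∧ P G := by
  unfold prob
  simp only [← expect_const_mul]
  rw [← expect_sum]
  congr 1
  ext G
  rw [Finset.sum_eq_single (G.deleteIncidenceSet w)]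
  · simp
  · intro H _ hH
    rw [if_neg fun h => hH h.1.symm, mul_zero]
  · simp

theorem prob_deleteIncidenceSet_eq (H : SimpleGraph V) :
    prob p (fun G => G.deleteIncidenceSet w = H ∧ IsIsolated G w) =
      (1 - p) ^ (Fintype.card V - 1) * prob p fun G => G.deleteIncidenceSet w = H := by
  classical
  by_cases hH : IsIsolated H w
  · set E₁ : Finset (Sym2 V) := Finset.univ.filter fun e => e ∈ H.edgeSet with hE₁
    set E₂ : Finset (Sym2 V) := Finset.univ.filter fun e =>
      (¬ e.IsDiag ∧ e ∉ H.edgeSet) ∧ w ∉ e with hE₂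
    have hw₁ : ∀ e ∈ E₁, w ∉ e := by
      intro e he hwe
      have he' : e ∈ H.edgeSet := (Finset.mem_filter.1 he).2
      exact isIsolated_iff.1 hH e (mem_pairsAt.2 ⟨hwe, H.not_isDiag_of_mem_edgeSet he'⟩) he'
    have hd₁ : ∀ e ∈ E₁, ¬ e.IsDiag := fun e he =>
      H.not_isDiag_of_mem_edgeSet (Finset.mem_filter.1 he).2
    have hd₂ : ∀ e ∈ E₂, ¬ e.IsDiag := fun e he => (Finset.mem_filter.1 he).2.1.1
    have hd₃ : ∀ e ∈ E₂ ∪ pairsAt w, ¬ e.IsDiag := fun e he =>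
      (Finset.mem_union.1 he).elim (hd₂ e) fun h => (mem_pairsAt.1 h).2
    have h12 : Disjoint E₁ E₂ := Finset.disjoint_left.2 fun e h h' =>
      (Finset.mem_filter.1 h').2.1.2 (Finset.mem_filter.1 h).2
    have h1s : Disjoint E₁ (pairsAt w) := Finset.disjoint_left.2 fun e h h' =>
      hw₁ e h (mem_pairsAt.1 h').1
    have h2s : Disjoint E₂ (pairsAt w) := Finset.disjoint_left.2 fun e h h' =>
      (Finset.mem_filter.1 h).2.2 (mem_pairsAt.1 h').1
    have hiff : ∀ G : SimpleGraph V, G.deleteIncidenceSet w = H ↔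
        (∀ e ∈ E₁, e ∈ G.edgeSet) ∧ ∀ e ∈ E₂, e ∉ G.edgeSet := by
      intro G
      constructor
      · intro hGH
        constructor
        · intro e he
          have he' : e ∈ H.edgeSet := (Finset.mem_filter.1 he).2
          rw [← hGH] at he'
          exact SimpleGraph.edgeSet_mono (G.deleteIncidenceSet_le w) he'
        · intro e he heG
          obtain ⟨⟨-, heH⟩, hwe⟩ := (Finset.mem_filter.1 he).2
          rw [← hGH] at heH
          refine heH ?_
          induction e with | _ a b
          rw [SimpleGraph.mem_edgeSet, deleteIncidenceSet_adj]
          exact ⟨heG, fun ha => hwe (ha ▸ Sym2.mem_mk_left _ _),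
            fun hb => hwe (hb ▸ Sym2.mem_mk_right _ _)⟩
      · rintro ⟨h1, h2⟩
        ext a b
        rw [deleteIncidenceSet_adj]
        constructor
        · rintro ⟨hab, ha, hb⟩
          by_contra hn
          refine h2 s(a, b) (Finset.mem_filter.2 ⟨Finset.mem_univ _, ⟨?_, hn⟩, ?_⟩) hab
          · exact hab.ne
          · rw [Sym2.mem_iff]
            rintro (h | h)
            exacts [ha h.symm, hb h.symm]
        · intro hab
          have hmem : s(a, b) ∈ E₁ := Finset.mem_filter.2 ⟨Finset.mem_univ _, hab⟩
          have hw := hw₁ _ hmem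
          exact ⟨h1 _ hmem, fun ha => hw (ha ▸ Sym2.mem_mk_left _ _),
            fun hb => hw (hb ▸ Sym2.mem_mk_right _ _)⟩
    have e1 : (fun G : SimpleGraph V => G.deleteIncidenceSet w = H) = fun G =>
        (∀ e ∈ E₁, e ∈ G.edgeSet) ∧ ∀ e ∈ E₂, e ∉ G.edgeSet := by
      ext G
      exact hiff G
    have e2 : (fun G : SimpleGraph V => G.deleteIncidenceSet w = H ∧ IsIsolated G w) = fun G =>
        (∀ e ∈ E₁, e ∈ G.edgeSet) ∧ ∀ e ∈ E₂ ∪ pairsAt w, e ∉ G.edgeSet := by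
      ext G
      rw [hiff, isIsolated_iff]
      simp only [Finset.mem_union]
      exact ⟨fun h => ⟨h.1.1, fun e he => he.elim (h.1.2 e) (h.2 e)⟩,
        fun h => ⟨⟨h.1, fun e he => h.2 e (.inl he)⟩, fun e he => h.2 e (.inr he)⟩⟩
    rw [e1, e2, prob_cylinder h12 hd₁ hd₂,
      prob_cylinder (Finset.disjoint_union_right.2 ⟨h12, h1s⟩) hd₁ hd₃,
      Finset.card_union_of_disjoint h2s, card_pairsAt, pow_add]
    ring
  · have h : ∀ G : SimpleGraph V, ¬ G.deleteIncidenceSet w = H := by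
      rintro G rfl
      exact hH (isIsolated_deleteIncidenceSet G w)
    simp [h, prob, expect]

open Classical in
/-- The graph obtained by isolating `w` is independent of the event that `w` is isolated. -/
theorem expect_mul_isIsolated (F : SimpleGraph V → ℝ) :
    expect p (fun G => F (G.deleteIncidenceSet w) * if IsIsolated G w then 1 else 0) =
      (1 - p) ^ (Fintype.card V - 1) * expect p fun G => F (G.deleteIncidenceSet w) := by
  have h := expect_eq_sum_prob (p := p) (w := w) F fun _ => True
  simp only [if_true, mul_one, and_true] at h
  rw [expect_eq_sum_prob, h, Finset.mul_sum]
  refine Finset.sum_congr rfl fun H _ => ?_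
  rw [prob_deleteIncidenceSet_eq]
  ring

open Classical in
/-- On the event that `w` is isolated, isolating `w` changes nothing. -/
theorem expect_mul_isIsolated' (F : SimpleGraph V → ℝ) :
    expect p (fun G => F G * if IsIsolated G w then 1 else 0) =
      (1 - p) ^ (Fintype.card V - 1) * expect p fun G => F (G.deleteIncidenceSet w) := by
  rw [← expect_mul_isIsolated]
  congr 1
  ext G
  split_ifs with h
  · rw [deleteIncidenceSet_of_isIsolated h]
  · simp

open Classical in
/-- The number of isolated vertices. -/
noncomputable def isolatedCount (G : SimpleGraph V) : ℝ :=
  ∑ w : V, if IsIsolated G w then (1 : ℝ) else 0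

theorem expect_mul_isolatedCount (F : SimpleGraph V → ℝ) :
    expect p (fun G => F G * isolatedCount G) =
      (1 - p) ^ (Fintype.card V - 1) * ∑ w, expect p fun G => F (G.deleteIncidenceSet w) := by
  simp only [isolatedCount, Finset.mul_sum, expect_sum]
  exact Finset.sum_congr rfl fun w _ => expect_mul_isIsolated' F

theorem expect_isolatedCount :
    expect p (fun G : SimpleGraph V => isolatedCount G) =
      (1 - p) ^ (Fintype.card V - 1) * Fintype.card V := by
  have h := expect_mul_isolatedCount (V := V) (p := p) fun _ => 1
  simpa [expect_const] using h

theorem prob_isIsolated_deleteIncidenceSet_le (hp0 : 0 ≤ p) (hp1 : p ≤ 1) (hw : w' ≠ w) :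
    prob p (fun G : SimpleGraph V => IsIsolated (G.deleteIncidenceSet w) w') ≤
      (1 - p) ^ (Fintype.card V - 2) := by
  have hd : ∀ e ∈ (pairsAt w').erase s(w', w), ¬ e.IsDiag := fun e he =>
    (mem_pairsAt.1 (Finset.mem_of_mem_erase he)).2
  have h := prob_cylinder (p := p) (Finset.disjoint_empty_left ((pairsAt w').erase s(w', w)))
    (by simp) hd
  have hmem : s(w', w) ∈ pairsAt w' := mem_pairsAt.2 ⟨Sym2.mem_mk_left _ _, hw⟩
  rw [Finset.card_empty, pow_zero, one_mul, Finset.card_erase_of_mem hmem, card_pairsAt,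
    Nat.sub_sub] at h
  rw [← h]
  refine prob_mono hp0 hp1 fun G hG => ⟨by simp, fun e he heG => ?_⟩
  obtain ⟨hne, he⟩ := Finset.mem_erase.1 he
  obtain ⟨y, -, rfl⟩ := Finset.mem_image.1 he
  refine hG y ?_
  rw [deleteIncidenceSet_adj]
  exact ⟨heG, hw, fun hy => hne (by rw [hy])⟩

/-- An upper bound for the variance of the number of isolated vertices. -/
theorem expect_isolatedCount_sub_sq_le (hp0 : 0 ≤ p) (hp1 : p ≤ 1) (hV : 2 ≤ Fintype.card V) :
    expect p (fun G : SimpleGraph V =>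
        (isolatedCount G - (1 - p) ^ (Fintype.card V - 1) * Fintype.card V) ^ 2) ≤
      (Fintype.card V : ℝ) * (1 - p) ^ (Fintype.card V - 1) * (1 + Fintype.card V * p) := by
  classical
  have h1p : 0 ≤ 1 - p := by linarith
  set n := Fintype.card V with hn
  set q := (1 - p) ^ (n - 1) with hq
  set r := (1 - p) ^ (n - 2) with hr
  have hqr : q = (1 - p) * r := by
    rw [hq, hr, ← pow_succ']
    congr 1
    omega
  have hr0 : 0 ≤ r := by positivity
  have hr1 : r ≤ 1 := pow_le_one₀ h1p (by linarith)
  have hsq : expect p (fun G : SimpleGraph V => isolatedCount G * isolatedCount G) ≤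
      q * (n + n * (n * r)) := by
    rw [expect_mul_isolatedCount]
    refine mul_le_mul_of_nonneg_left ?_ (by positivity)
    have hw : ∀ w ∈ (Finset.univ : Finset V),
        expect p (fun G : SimpleGraph V => isolatedCount (G.deleteIncidenceSet w)) ≤
        1 + n * r := by
      intro w _
      simp only [isolatedCount, expect_sum]
      rw [← Finset.add_sum_erase _ _ (Finset.mem_univ w)]
      refine add_le_add ?_ ?_
      · simp only [isIsolated_deleteIncidenceSet, if_true, expect_const]
        exact le_rfl
      · refine (Finset.sum_le_card_nsmul _ _ r fun w' hw' =>
          prob_isIsolated_deleteIncidenceSet_le hp0 hp1 (Finset.ne_of_mem_erase hw')).trans ?_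
        rw [nsmul_eq_mul]
        refine mul_le_mul_of_nonneg_right ?_ hr0
        exact_mod_cast (Finset.card_le_univ _)
    refine (Finset.sum_le_sum hw).trans (le_of_eq ?_)
    rw [Finset.sum_const, Finset.card_univ, nsmul_eq_mul]
    ring
  have hexp : expect p (fun G : SimpleGraph V => (isolatedCount G - q * n) ^ 2) =
      expect p (fun G : SimpleGraph V => isolatedCount G * isolatedCount G) - (q * n) ^ 2 := by
    have h1 : (fun G : SimpleGraph V => (isolatedCount G - q * n) ^ 2) = fun G =>
        isolatedCount G * isolatedCount G - (2 * (q * n) * isolatedCount G - (q * n) ^ 2) := by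
      ext G
      ring
    rw [h1, expect_sub, expect_sub, expect_const_mul, expect_const, expect_isolatedCount]
    ring
  rw [hexp]
  have h3 : q * (n + n * (n * r)) - (q * n) ^ 2 = n * q * (1 + n * p * r) := by
    rw [hqr]
    ring
  have h4 : n * q * (1 + n * p * r) ≤ n * q * (1 + n * p) := by
    have hq0 : 0 ≤ q := by positivity
    have : (n : ℝ) * p * r ≤ n * p := mul_le_of_le_one_right (by positivity) hr1
    gcongr
  linarith

/-- A function that decreases on average by at least `n δ` in total when single vertices are
isolated is negatively correlated with the number of isolated vertices, and so has a large
variance. -/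
theorem le_expect_sub_sq (hp0 : 0 ≤ p) (hp1 : p ≤ 1) (hV : 2 ≤ Fintype.card V)
    (f : SimpleGraph V → ℝ) (m : ℝ)
    (hm : m = expect p f) {δ : ℝ} (hδ : 0 ≤ δ)
    (hf : Fintype.card V * δ ≤
      expect p fun G : SimpleGraph V => ∑ w, (f G - f (G.deleteIncidenceSet w))) :
    Fintype.card V * (1 - p) ^ (Fintype.card V - 1) * δ ^ 2 / (1 + Fintype.card V * p) ≤
      expect p fun G => (f G - m) ^ 2 := by
  have h1p : 0 ≤ 1 - p := by linarith
  set n := Fintype.card V with hn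
  set q := (1 - p) ^ (n - 1) with hq
  have hq0 : 0 ≤ q := by positivity
  set b : ℝ := 1 + n * p with hb
  have hb0 : 0 < b := by positivity
  set g : SimpleGraph V → ℝ := fun G => isolatedCount G - q * n with hg
  have hvar : expect p (fun G => g G ^ 2) ≤ n * q * b :=
    expect_isolatedCount_sub_sq_le hp0 hp1 hV
  have hcov : expect p (fun G => (f G - m) * g G) ≤ -(q * (n * δ)) := by
    have h1 : (fun G => (f G - m) * g G) = fun G =>
        f G * isolatedCount G - (m * isolatedCount G + (q * n * f G - q * n * m)) := by
      ext G
      simp only [hg]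
      ring
    rw [h1, expect_sub, expect_add, expect_sub, expect_const_mul, expect_const_mul, expect_const,
      expect_isolatedCount, expect_mul_isolatedCount, ← hm]
    have h2 : expect p (fun G : SimpleGraph V => ∑ w, (f G - f (G.deleteIncidenceSet w))) =
        n * m - ∑ w, expect p fun G => f (G.deleteIncidenceSet w) := by
      rw [expect_sum]
      simp only [expect_sub, ← hm]
      rw [Finset.sum_sub_distrib, Finset.sum_const, Finset.card_univ, nsmul_eq_mul]
    rw [h2] at hf
    have h3 := mul_le_mul_of_nonneg_left hf hq0
    linarith
  -- The Cauchy-Schwarz inequality, with the factor `x` of `g` left free; `x = δ / b` is optimal.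
  have hpoint : ∀ x : ℝ, -(2 * x) * expect p (fun G => (f G - m) * g G) -
      x ^ 2 * expect p (fun G => g G ^ 2) ≤ expect p fun G => (f G - m) ^ 2 := by
    intro x
    rw [← expect_const_mul, ← expect_const_mul, ← expect_sub]
    refine expect_mono hp0 hp1 fun G => ?_
    nlinarith [sq_nonneg (f G - m + x * g G)]
  have h := hpoint (δ / b)
  have hx : 0 ≤ δ / b := by positivity
  have h5 := mul_le_mul_of_nonneg_left hcov hx
  have h6 := mul_le_mul_of_nonneg_left hvar (sq_nonneg (δ / b))
  have h7 : n * q * δ ^ 2 / b = 2 * (δ / b) * (q * (n * δ)) - (δ / b) ^ 2 * (n * q * b) := by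
    field_simp
    ring
  rw [h7]
  linarith

end Isolated

/-! ### The variance of `L̃_k` -/

section Main

open MeasureTheory

theorem localL_sub_localL {V : Type*} [Fintype V] (k : ℕ) (G H : SimpleGraph V) :
    localL k G - localL k H = ∑ v, (localPhi H k v - localPhi G k v) := by
  rw [localL, localL, Finset.sum_sub_distrib]
  ring

variable {V : Type*} [Fintype V]

instance instMeasurableSingletonClassSimpleGraph : MeasurableSingletonClass (SimpleGraph V) where
  measurableSet_singleton G := by
    have h : ({G} : Set (SimpleGraph V)) = edgeSet ⁻¹' {G.edgeSet} := by
      ext H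
      simp
    rw [h]
    exact measurableEmbedding_edgeSet.measurable (MeasurableSet.singleton _)

theorem binomialRandom_real_singleton (p : unitInterval) (G : SimpleGraph V) :
    (binomialRandom V p).real {G} = weight (p : ℝ) G := by
  rw [measureReal_def, binomialRandom_singleton]
  simp [weight]

variable [DecidableEq V]

theorem integral_binomialRandom (p : unitInterval) (F : SimpleGraph V → ℝ) :
    ∫ G, F G ∂(binomialRandom V p) = expect (p : ℝ) F := by
  rw [integral_fintype .of_finite]
  simp only [binomialRandom_real_singleton, smul_eq_mul]
  rfl

theorem variance_binomialRandom (p : unitInterval) (F : SimpleGraph V → ℝ) :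
    ProbabilityTheory.variance F (binomialRandom V p) =
      expect (p : ℝ) fun G => (F G - expect (p : ℝ) F) ^ 2 := by
  rw [ProbabilityTheory.variance_eq_integral (Measurable.of_discrete.aemeasurable),
    integral_binomialRandom, integral_binomialRandom]

/-- Isolating a vertex decreases `L̃_k` by a constant on average. -/
theorem le_expect_sum_localL_sub {c : ℝ} (hc : 20 ≤ c) {k : ℕ} (hk : 100 ≤ k)
    (hcn : c ≤ Fintype.card V)
    (hlarge : 200 ^ 2 * (1 + k) * ∑ s ∈ Finset.range (2 * k + 2),
      ((s + 1 : ℕ) : ℝ) ^ (s + 2) * c ^ s ≤ 1 / 20 * Fintype.card V) :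
    (Fintype.card V : ℝ) * (1 / 4) ≤ expect (c / Fintype.card V) fun G : SimpleGraph V =>
      ∑ w, (localL k G - localL k (G.deleteIncidenceSet w)) := by
  classical
  set n := Fintype.card V with hn
  have hn0 : (0 : ℝ) < n := by linarith
  set p := c / n with hp
  have hp0 : 0 ≤ p := by positivity
  have hp1 : p ≤ 1 := (div_le_one hn0).2 hcn
  have hnp : n * p = c := by
    rw [hp]
    field_simp
  have hv : ∀ v : V, 1 / 4 ≤ expect p fun G : SimpleGraph V =>
      ∑ w, (localPhi (G.deleteIncidenceSet w) k v - localPhi G k v) := by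
    intro v
    refine le_trans ?_ (expect_mono hp0 hp1 fun G => le_sum_localPhi_sub (by omega) G v)
    have hball : expect p (fun G : SimpleGraph V =>
        if HasHugeBall G k v then (Fintype.card V : ℝ) * (1 + k) else 0) ≤ 1 / 20 := by
      have h1 : (fun G : SimpleGraph V =>
          if HasHugeBall G k v then (Fintype.card V : ℝ) * (1 + k) else 0) = fun G =>
          ((n : ℝ) * (1 + k)) * if HasHugeBall G k v then 1 else 0 := by
        ext G
        rw [mul_ite, mul_one, mul_zero]
      rw [h1, expect_const_mul]
      have h2 := prob_hasHugeBall_le (k := k) hp0 hp1 v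
      rw [← hn, hnp] at h2
      refine (mul_le_mul_of_nonneg_left h2 (by positivity)).trans ?_
      have h3 : ∀ S : ℝ, 200 ^ 2 * (1 + (k : ℝ)) * S ≤ 1 / 20 * n →
          n * (1 + (k : ℝ)) * (200 ^ 2 / (n : ℝ) ^ 2 * S) ≤ 1 / 20 := by
        intro S hS
        have h4 : n * (1 + (k : ℝ)) * (200 ^ 2 / (n : ℝ) ^ 2 * S) =
            200 ^ 2 * (1 + (k : ℝ)) * S / n := by
          field_simp
        rw [h4, div_le_iff₀ hn0]
        exact hS
      exact h3 _ hlarge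
    have hpocket : expect p (fun G : SimpleGraph V => pocketCount G k v) ≤ 7 / 10 :=
      (expect_pocketCount_le hp0 hp1 v).trans (sum_pocketTerm_le hc hk hcn)
    rw [expect_sub, expect_sub, expect_const]
    linarith
  have hswap : (fun G : SimpleGraph V => ∑ w, (localL k G - localL k (G.deleteIncidenceSet w))) =
      fun G => ∑ v, ∑ w, (localPhi (G.deleteIncidenceSet w) k v - localPhi G k v) := by
    ext G
    simp only [localL_sub_localL]
    exact Finset.sum_comm
  rw [hswap, expect_sum]
  have h := Finset.card_nsmul_le_sum Finset.univ _ _ fun v _ => hv v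
  rwa [Finset.card_univ, nsmul_eq_mul] at h

/-- A lower bound for the probability of being isolated. -/
theorem exp_neg_le_one_sub_pow {c : ℝ} {n : ℕ} (hc : 0 < c) (hcn : 2 * c ≤ n) :
    Real.exp (-2 * c) ≤ (1 - c / n) ^ (n - 1) := by
  have hn0 : (0 : ℝ) < n := by linarith
  set p := c / n with hp
  have hp0 : 0 ≤ p := by positivity
  have hp2 : p ≤ 1 / 2 := by
    rw [hp, div_le_iff₀ hn0]
    linarith
  have h1 : Real.exp (-(2 * p)) ≤ 1 - p := by
    rw [Real.exp_neg, inv_le_comm₀ (Real.exp_pos _) (by linarith), inv_eq_one_div,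
      div_le_iff₀ (by linarith)]
    have := Real.add_one_le_exp (2 * p)
    nlinarith
  calc Real.exp (-2 * c) = Real.exp (-(2 * p)) ^ n := by
        rw [← Real.exp_nat_mul]
        congr 1
        rw [hp]
        field_simp
    _ ≤ (1 - p) ^ n := by gcongr
    _ ≤ (1 - p) ^ (n - 1) := pow_le_pow_of_le_one (by linarith) (by linarith) (Nat.sub_le _ _)

end Main

end LongCycle

theorem lemma6p1 (c : ℝ) (hc : 20 ≤ c) (k : ℕ) (hk : 100 ≤ k) :
    ∃ n₀ : ℕ, ∀ n : ℕ, n₀ ≤ n →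
      ∃ hp : c / (n : ℝ) ∈ unitInterval,
        2 * (1 / 12 * Real.exp (-20 * c)) * (n : ℝ) ≤
          ProbabilityTheory.variance (LongCycle.localL k : SimpleGraph (Fin n) → ℝ)
            (SimpleGraph.binomialRandom (Fin n) ⟨c / (n : ℝ), hp⟩) := by
  set K : ℝ := 200 ^ 2 * (1 + k) * ∑ s ∈ Finset.range (2 * k + 2),
    ((s + 1 : ℕ) : ℝ) ^ (s + 2) * c ^ s with hK
  obtain ⟨N, hN⟩ := exists_nat_ge (max (2 * c) (20 * K))
  refine ⟨N, fun n hn => ?_⟩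
  have hnN : (N : ℝ) ≤ n := by exact_mod_cast hn
  have hcn : 2 * c ≤ n := (le_max_left _ _).trans (hN.trans hnN)
  have hKn : 20 * K ≤ n := (le_max_right _ _).trans (hN.trans hnN)
  have hn0 : (0 : ℝ) < n := by linarith
  have hc0 : 0 < c := by linarith
  have hp0 : 0 ≤ c / (n : ℝ) := by positivity
  have hp1 : c / (n : ℝ) ≤ 1 := (div_le_one hn0).2 (by linarith)
  refine ⟨⟨hp0, hp1⟩, ?_⟩
  rw [LongCycle.variance_binomialRandom]
  have hcard : Fintype.card (Fin n) = n := Fintype.card_fin n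
  have hn2 : 2 ≤ n := by
    have : (2 : ℝ) ≤ n := by linarith
    exact_mod_cast this
  have hslope := LongCycle.le_expect_sum_localL_sub (V := Fin n) hc hk
    (by rw [hcard]; linarith) (by rw [hcard, ← hK]; linarith)
  rw [hcard] at hslope
  have hvar := LongCycle.le_expect_sub_sq (V := Fin n) hp0 hp1 (by rw [hcard]; exact hn2)
    (LongCycle.localL k) _ rfl (δ := 1 / 4) (by norm_num) (by rw [hcard]; exact hslope)
  refine le_trans ?_ hvar
  rw [hcard]
  have hnp : n * (c / n) = c := by field_simp
  rw [hnp, le_div_iff₀ (by linarith)]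
  have hq := LongCycle.exp_neg_le_one_sub_pow hc0 hcn
  have he : Real.exp (-20 * c) * (1 + 18 * c) ≤ Real.exp (-2 * c) := by
    have h1 : Real.exp (-2 * c) = Real.exp (-20 * c) * Real.exp (18 * c) := by
      rw [← Real.exp_add]
      congr 1
      ring
    have h2 := Real.add_one_le_exp (18 * c)
    rw [h1]
    gcongr
    linarith
  have he0 := Real.exp_pos (-20 * c)
  calc 2 * (1 / 12 * Real.exp (-20 * c)) * n * (1 + c)
      = n * (Real.exp (-20 * c) * ((1 + c) / 6)) := by ring
    _ ≤ n * (Real.exp (-20 * c) * (1 + 18 * c) * (1 / 4) ^ 2) := by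
      rw [mul_assoc (Real.exp (-20 * c))]
      gcongr
      linarith
    _ ≤ n * ((1 - c / n) ^ (n - 1) * (1 / 4) ^ 2) := by
      have := he.trans hq
      gcongr
    _ = n * (1 - c / n) ^ (n - 1) * (1 / 4) ^ 2 := by ring
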